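/- Let $n\ge 2$, $-1<a<1$, let $e_1,\dots,e_{n+1}$ be the standard basis of $\mathbb R^{n+1}$, and identify $\mathbb R^n$ with $\mathbb R e_1\oplus\cdots\oplus\mathbb R e_n$. Put $S^n_a=\{\eta\in S^n:\eta_{n+1}<a\}$ and $S^n_+=\{\xi\in S^n:\xi_{n+1}\ge 0\}$, where $S^n\subset\mathbb R^{n+1}$ is the unit sphere with its surface measure $d\eta$. For $\xi\in S^n_+$ let $\gamma_a(\xi)=\{\eta\in S^n_a:\xi\cdot\eta=a\xi_{n+1}\}$, and let $$(\mathcal S_af)(\xi)=\int_{\gamma_a(\xi)}f(\eta)\,d_{\gamma_a}\eta,$$ where $d_{\gamma_a}\eta$ is the surface measure on $\gamma_a(\xi)$, a part of an $(n-1)$-dimensional round sphere. For $x\in\mathbb R^n$ let $$D(x)=\sqrt{a+1}\,\sqrt{|x|^2(1-a)+a+1},\quad P(x)=\frac{a(a+1)+D(x)}{|x|^2+(a+1)^2},\quad Q(x)=\frac{a|x|^2-(a+1)D(x)}{|x|^2+(a+1)^2},$$ $$\pi(x)=P(x)\,x+Q(x)\,e_{n+1}\in S^n_a,\qquad (\mathcal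 U_af)(x)=\frac{(a+1)P(x)^{n-1}}{D(x)}\,f(\pi(x)).$$ For a function $g$ on $\mathbb R^n$ and $\theta\in S^{n-1}$, $t\in\mathbb R$, let $(Rg)(\theta,t)=\int_{\theta^\perp}g(t\theta+u)\,du$ be the hyperplane Radon transform, where $du$ is Lebesgue measure on $\theta^\perp\subset\mathbb R^n$. For a function $\Phi$ on $S^{n-1}\times\mathbb R$ and $\xi=\sqrt{1-s^2}\,\theta+s\,e_{n+1}$ with $\theta\in S^{n-1}$, $0\le s<1$, let $$(\mathcal V_a\Phi)(\xi)=\sqrt{\frac{1-a^2s^2}{1-s^2}}\;\Phi\!\left(\theta,\frac{(a+1)s}{\sqrt{1-s^2}}\right).$$ **Theorem.** Let $f\in L^1(S^n_a)$ be real- or complex-valued. Then for almost every $\xi\in S^n_+$ (with respect to surface measure) the integrals defining $(\mathcal S_af)(\xi)$ and $(\mathcal V_aR\,\mathcal U_af)(\xi)$ converge absolutely, and $$(\mathcal S_af)(\xi)=(\mathcal V_aR\,\mathcal U_af)(\xi).$$ -/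

import Mathlib

open MeasureTheory

noncomputable section

namespace SliceTransform

/-- The last coordinate `η_{n+1} = η · e_{n+1}` of a point of `ℝⁿ⁺¹`. -/
def height {n : ℕ} (η : EuclideanSpace ℝ (Fin (n + 1))) : ℝ := η (Fin.last n)

/-- The horizontal part `η' = (η_1, …, η_n)` of a point of `ℝⁿ⁺¹`. -/
def horiz {n : ℕ} (η : EuclideanSpace ℝ (Fin (n + 1))) : EuclideanSpace ℝ (Fin n) :=
  WithLp.toLp 2 fun i => η i.castSucc

/-- The point `x + y e_{n+1}` of `ℝⁿ⁺¹`, for `x ∈ ℝⁿ` and `y ∈ ℝ`. -/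
def join {n : ℕ} (x : EuclideanSpace ℝ (Fin n)) (y : ℝ) : EuclideanSpace ℝ (Fin (n + 1)) :=
  WithLp.toLp 2 (Fin.snoc (fun i => x i) y : Fin (n + 1) → ℝ)

/-- The unit sphere `Sⁿ` in `ℝⁿ⁺¹`. -/
def unitSphere (n : ℕ) : Set (EuclideanSpace ℝ (Fin (n + 1))) := Metric.sphere 0 1

/-- The truncated sphere `Sⁿ_a = {η ∈ Sⁿ : η_{n+1} < a}`. -/
def truncSphere (n : ℕ) (a : ℝ) : Set (EuclideanSpace ℝ (Fin (n + 1))) :=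
  {η | η ∈ unitSphere n ∧ height η < a}

/-- The upper hemisphere `Sⁿ₊ = {ξ ∈ Sⁿ : ξ_{n+1} ≥ 0}`. -/
def upperHemisphere (n : ℕ) : Set (EuclideanSpace ℝ (Fin (n + 1))) :=
  {ξ | ξ ∈ unitSphere n ∧ 0 ≤ height ξ}

/-- The (unnormalized) surface measure `dη` of the unit sphere `Sⁿ`, as a measure on `ℝⁿ⁺¹`
carried by `Sⁿ`. -/
def sphereMeasure (n : ℕ) : Measure (EuclideanSpace ℝ (Fin (n + 1))) :=
  (volume : Measure (EuclideanSpace ℝ (Fin (n + 1)))).toSphere.map Subtype.val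

/-- The surface measure of the round sphere `{c + r u : u ∈ W, |u| = 1}` with center `c` and
radius `r > 0` in the affine subspace `c + W`: the surface measure of the unit sphere of `W`
(with respect to the Lebesgue measure of `W`), transported by `u ↦ c + r u` and multiplied
by `r` to the power `dim W - 1`. -/
def roundSphereMeasure {E : Type*} [NormedAddCommGroup E] [InnerProductSpace ℝ E]
    [FiniteDimensional ℝ E] [MeasurableSpace E] [BorelSpace E]
    (W : Submodule ℝ E) (c : E) (r : ℝ) : Measure E :=
  ENNReal.ofReal (r ^ (Module.finrank ℝ W - 1)) •
    (@volume W measureSpaceOfInnerProductSpace).toSphere.map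
      (fun u : Metric.sphere (0 : W) 1 => c + r • ((u : W) : E))

/-- The truncated slice
`γ_a(ξ) = {η ∈ Sⁿ_a : ξ · η = a ξ_{n+1}} = {η ∈ Sⁿ_a : ξ · (η - a e_{n+1}) = 0}`. -/
def slice {n : ℕ} (a : ℝ) (ξ : EuclideanSpace ℝ (Fin (n + 1))) :
    Set (EuclideanSpace ℝ (Fin (n + 1))) :=
  {η | η ∈ truncSphere n a ∧ inner ℝ ξ η = a * height ξ}

/-- The surface measure of the complete slice `{η ∈ Sⁿ : ξ · η = a ξ_{n+1}}`, which (for `ξ ∈ Sⁿ`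
and `|a| < 1`) is the round sphere in the hyperplane `a ξ_{n+1} ξ + ξ^⊥` with center `a ξ_{n+1} ξ`
and radius `√(1 - a² ξ_{n+1}²)`. -/
def sliceMeasure {n : ℕ} (a : ℝ) (ξ : EuclideanSpace ℝ (Fin (n + 1))) :
    Measure (EuclideanSpace ℝ (Fin (n + 1))) :=
  roundSphereMeasure (Submodule.span ℝ {ξ})ᗮ ((a * height ξ) • ξ)
    (Real.sqrt (1 - a ^ 2 * height ξ ^ 2))

/-- The truncated slice transform `(𝒮_a f)(ξ) = ∫_{γ_a(ξ)} f(η) dη`. -/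
def sliceTransform {𝕜 : Type*} [RCLike 𝕜] {n : ℕ} (a : ℝ)
    (f : EuclideanSpace ℝ (Fin (n + 1)) → 𝕜) (ξ : EuclideanSpace ℝ (Fin (n + 1))) : 𝕜 :=
  ∫ η in slice a ξ, f η ∂(sliceMeasure a ξ)

/-- `D(x) = √(a + 1) √(|x|² (1 - a) + a + 1)`. -/
def D {n : ℕ} (a : ℝ) (x : EuclideanSpace ℝ (Fin n)) : ℝ :=
  Real.sqrt (a + 1) * Real.sqrt (‖x‖ ^ 2 * (1 - a) + a + 1)

/-- `P(x) = (a (a + 1) + D(x)) / (|x|² + (a + 1)²)`. -/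
def P {n : ℕ} (a : ℝ) (x : EuclideanSpace ℝ (Fin n)) : ℝ :=
  (a * (a + 1) + D a x) / (‖x‖ ^ 2 + (a + 1) ^ 2)

/-- `Q(x) = (a |x|² - (a + 1) D(x)) / (|x|² + (a + 1)²)`. -/
def Q {n : ℕ} (a : ℝ) (x : EuclideanSpace ℝ (Fin n)) : ℝ :=
  (a * ‖x‖ ^ 2 - (a + 1) * D a x) / (‖x‖ ^ 2 + (a + 1) ^ 2)

/-- The modified stereographic projection `π(x) = P(x) x + Q(x) e_{n+1}` from `ℝⁿ` onto `Sⁿ_a`,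
with pole `(0, …, 0, a)`. -/
def proj {n : ℕ} (a : ℝ) (x : EuclideanSpace ℝ (Fin n)) : EuclideanSpace ℝ (Fin (n + 1)) :=
  join (P a x • x) (Q a x)

/-- The operator `(𝒰_a f)(x) = (a + 1) P(x)ⁿ⁻¹ / D(x) · f(π(x))`. -/
def opU {𝕜 : Type*} [RCLike 𝕜] {n : ℕ} (a : ℝ) (f : EuclideanSpace ℝ (Fin (n + 1)) → 𝕜)
    (x : EuclideanSpace ℝ (Fin n)) : 𝕜 :=
  ((a + 1) * P a x ^ (n - 1) / D a x) • f (proj a x)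

/-- Lebesgue measure on the subspace `θ^⊥` of `ℝⁿ`. -/
def perpMeasure {n : ℕ} (θ : EuclideanSpace ℝ (Fin n)) : Measure (Submodule.span ℝ {θ})ᗮ :=
  @volume _ measureSpaceOfInnerProductSpace

/-- The hyperplane Radon transform `(R g)(θ, t) = ∫_{θ^⊥} g(tθ + u) du`, for a unit vector `θ`
and `t ∈ ℝ`. -/
def radon {𝕜 : Type*} [RCLike 𝕜] {n : ℕ} (g : EuclideanSpace ℝ (Fin n) → 𝕜)
    (θ : EuclideanSpace ℝ (Fin n)) (t : ℝ) : 𝕜 :=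
  ∫ u : (Submodule.span ℝ {θ})ᗮ, g (t • θ + (u : EuclideanSpace ℝ (Fin n))) ∂(perpMeasure θ)

/-- The direction `θ = ξ' / |ξ'| ∈ Sⁿ⁻¹` in `ξ = √(1 - s²) θ + s e_{n+1}`, for `ξ ∈ Sⁿ` different
from the two poles (at the poles this is the zero vector). -/
def dir {n : ℕ} (ξ : EuclideanSpace ℝ (Fin (n + 1))) : EuclideanSpace ℝ (Fin n) :=
  ‖horiz ξ‖⁻¹ • horiz ξ

/-- The number `t = (a + 1) s / √(1 - s²)`, where `s = ξ_{n+1}`. -/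
def offset {n : ℕ} (a : ℝ) (ξ : EuclideanSpace ℝ (Fin (n + 1))) : ℝ :=
  (a + 1) * height ξ / Real.sqrt (1 - height ξ ^ 2)

/-- The operator `(𝒱_a Φ)(ξ) = √((1 - a² s²) / (1 - s²)) Φ(θ, (a + 1) s / √(1 - s²))`, where
`ξ = √(1 - s²) θ + s e_{n+1}`. -/
def opV {𝕜 : Type*} [RCLike 𝕜] {n : ℕ} (a : ℝ) (Φ : EuclideanSpace ℝ (Fin n) → ℝ → 𝕜)
    (ξ : EuclideanSpace ℝ (Fin (n + 1))) : 𝕜 :=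
  Real.sqrt ((1 - a ^ 2 * height ξ ^ 2) / (1 - height ξ ^ 2)) • Φ (dir ξ) (offset a ξ)

end SliceTransform

end

open MeasureTheory

noncomputable section

namespace SliceTransform

open Set Metric
open scoped ENNReal

/-! ### The gauge of a sphere whose center is displaced from the origin, and the shear onto its
level sets. -/

section Gauge

variable {W : Type*} [NormedAddCommGroup W] [InnerProductSpace ℝ W]

/-! Write e for the last basis vector. The map π is central projection from the interior point a e:
π(x) is the point of the sphere on the ray from a e through x - e, so ℝⁿ is placed at height -1. The
slice γ_a(ξ) lies in the hyperplane a e + ξ^⊥ through the center of projection, hence it is the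
image of a hyperplane {x · θ = t}, and the identity is a change of variables on each slice.

The Jacobian comes from `lintegral_toSphere_shift`, which projects half of a unit sphere with center
κ, ‖κ‖ < 1, from 0 to a hyperplane. Both sides are, up to the same factor, one integral over a half
space: the shear y ↦ y + ‖y‖κ and polar coordinates give the sphere, integration over parallel
hyperplanes gives the flat side. Applied in ξ^⊥ the lemma yields `setLIntegral_slice`, and then
`slice_integral_identity` at every ξ that is not a pole. Applied in ℝⁿ⁺¹ it yields
`setLIntegral_truncSphere`, with density (a + 1) Pⁿ / D.

For absolute convergence at almost every ξ, hyperplane integrals of |𝒰_a f| are integrated over all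
ξ, extended homogeneously to a cylinder in ℝⁿ⁺¹. By Fubini each x is counted with the volume of {‖v‖
≤ 1, |x · v| ≤ a + 1}, which is at most a constant times P(x) (`volume_layer_le`). This raises Pⁿ⁻¹
to Pⁿ, and the total is bounded by a constant times the L¹ norm of f. -/

theorem norm_sq_add_smul {V : Type*} [NormedAddCommGroup V]
    [InnerProductSpace ℝ V] (ι : V →ₗᵢ[ℝ] W) {ω : W} (hω : ‖ω‖ = 1)
    (hι : ∀ v, inner ℝ (ι v) ω = 0) (v : V) (t : ℝ) :
    ‖ι v + t • ω‖ ^ 2 = ‖v‖ ^ 2 + t ^ 2 := by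
  rw [norm_add_sq_real, inner_smul_right, hι, norm_smul, hω, ι.norm_map]
  simp

/-- The map `y ↦ y + ‖y‖ κ` carries spheres around the origin to spheres with displaced centers. -/
def shear (κ : W) (y : W) : W := y + ‖y‖ • κ

/-- The gauge whose unit sphere is the translate by `κ` of the unit sphere. -/
def gauge (κ : W) (w : W) : ℝ :=
  (Real.sqrt (inner ℝ w κ ^ 2 + (1 - ‖κ‖ ^ 2) * ‖w‖ ^ 2) - inner ℝ w κ) / (1 - ‖κ‖ ^ 2)

/-- The square root occurring in `gauge`. -/
def gaugeRoot (κ w : W) : ℝ := Real.sqrt (inner ℝ w κ ^ 2 + (1 - ‖κ‖ ^ 2) * ‖w‖ ^ 2)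

theorem gauge_eq (κ w : W) : gauge κ w = (gaugeRoot κ w - inner ℝ w κ) / (1 - ‖κ‖ ^ 2) := rfl

theorem neg_norm_le_inner {κ : W} (hκ : ‖κ‖ < 1) (y : W) : -‖y‖ ≤ inner ℝ y κ := by
  have h := abs_le.1 (abs_real_inner_le_norm y κ)
  nlinarith [norm_nonneg y, h.1]

theorem one_sub_norm_sq_pos {W : Type*} [NormedAddCommGroup W] {κ : W} (hκ : ‖κ‖ < 1) :
    0 < 1 - ‖κ‖ ^ 2 := by
  nlinarith [norm_nonneg κ]

/-- On the image of the shear the discriminant is the perfect square of ‖y‖ + y · κ, which is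
nonnegative because ‖κ‖ < 1. -/
theorem gauge_shear {κ : W} (hκ : ‖κ‖ < 1) (y : W) : gauge κ (shear κ y) = ‖y‖ := by
  have hc := one_sub_norm_sq_pos hκ
  have hb : inner ℝ (shear κ y) κ = inner ℝ y κ + ‖y‖ * ‖κ‖ ^ 2 := by
    simp [shear, inner_add_left, inner_smul_left]
  have hR : ‖shear κ y‖ ^ 2 = ‖y‖ ^ 2 + 2 * ‖y‖ * inner ℝ y κ + ‖y‖ ^ 2 * ‖κ‖ ^ 2 := by
    rw [shear, norm_add_sq_real, inner_smul_right, norm_smul, norm_norm]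
    ring
  have hs : inner ℝ (shear κ y) κ ^ 2 + (1 - ‖κ‖ ^ 2) * ‖shear κ y‖ ^ 2 =
      (‖y‖ + inner ℝ y κ) ^ 2 := by
    rw [hb, hR]; ring
  rw [gauge, hs, Real.sqrt_sq (by linarith [neg_norm_le_inner hκ y]), hb, div_eq_iff hc.ne']
  ring

theorem gauge_nonneg {κ : W} (hκ : ‖κ‖ < 1) (w : W) : 0 ≤ gauge κ w := by
  have hc := one_sub_norm_sq_pos hκ
  refine div_nonneg ?_ hc.le
  rw [sub_nonneg]
  refine (le_abs_self _).trans ?_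
  rw [← Real.sqrt_sq_eq_abs]
  exact Real.sqrt_le_sqrt (by nlinarith [sq_nonneg ‖w‖])

/-- The gauge is the nonnegative root N of the quadratic equation ‖w - Nκ‖² = N². Hence w - Nκ is
the preimage of w under the shear. -/
theorem norm_sub_gauge {κ : W} (hκ : ‖κ‖ < 1) (w : W) : ‖w - gauge κ w • κ‖ = gauge κ w := by
  have hc := one_sub_norm_sq_pos hκ
  have h0 := gauge_nonneg hκ w
  rw [← sq_eq_sq₀ (norm_nonneg _) h0, norm_sub_sq_real, inner_smul_right, norm_smul,
    Real.norm_of_nonneg h0]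
  have h1 : (1 - ‖κ‖ ^ 2) * gauge κ w + inner ℝ w κ =
      Real.sqrt (inner ℝ w κ ^ 2 + (1 - ‖κ‖ ^ 2) * ‖w‖ ^ 2) := by
    rw [gauge]; field_simp; ring
  have h2 := congrArg (· ^ 2) h1
  rw [Real.sq_sqrt (by positivity)] at h2
  have h3 : (1 - ‖κ‖ ^ 2) * (‖w‖ ^ 2 - 2 * (gauge κ w * inner ℝ w κ) + (gauge κ w * ‖κ‖) ^ 2 -
      gauge κ w ^ 2) = 0 := by
    linear_combination -h2
  linarith [(mul_eq_zero.1 h3).resolve_left hc.ne']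

theorem shear_sub_gauge {κ : W} (hκ : ‖κ‖ < 1) (w : W) : shear κ (w - gauge κ w • κ) = w := by
  rw [shear, norm_sub_gauge hκ, sub_add_cancel]

theorem shear_injective {κ : W} (hκ : ‖κ‖ < 1) : Function.Injective (shear κ) := by
  intro y y' h
  have hn : ‖y‖ = ‖y'‖ := by rw [← gauge_shear hκ y, ← gauge_shear hκ y', h]
  simpa [shear, hn] using h

theorem gauge_smul (κ : W) {c : ℝ} (hc : 0 ≤ c) (w : W) : gauge κ (c • w) = c * gauge κ w := by
  have : (c * inner ℝ w κ) ^ 2 + (1 - ‖κ‖ ^ 2) * (c * ‖w‖) ^ 2 =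
    c ^ 2 * (inner ℝ w κ ^ 2 + (1 - ‖κ‖ ^ 2) * ‖w‖ ^ 2) := by ring
  rw [gauge, gauge, real_inner_smul_left, norm_smul, Real.norm_of_nonneg hc, this,
    Real.sqrt_mul (sq_nonneg c), Real.sqrt_sq hc]
  ring

theorem continuous_gauge (κ : W) : Continuous (gauge κ) := by
  unfold gauge
  fun_prop

theorem continuous_shear (κ : W) : Continuous (shear κ) := by
  unfold shear
  fun_prop

theorem gaugeRoot_eq {κ : W} (hκ : ‖κ‖ < 1) (w : W) :
    gaugeRoot κ w = (1 - ‖κ‖ ^ 2) * gauge κ w + inner ℝ w κ := by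
  have hc := one_sub_norm_sq_pos hκ
  rw [gauge_eq]; field_simp; ring

theorem gaugeRoot_smul (κ : W) {c : ℝ} (hc : 0 ≤ c) (w : W) :
    gaugeRoot κ (c • w) = c * gaugeRoot κ w := by
  have : (c * inner ℝ w κ) ^ 2 + (1 - ‖κ‖ ^ 2) * (c * ‖w‖) ^ 2 =
    c ^ 2 * (inner ℝ w κ ^ 2 + (1 - ‖κ‖ ^ 2) * ‖w‖ ^ 2) := by ring
  rw [gaugeRoot, gaugeRoot, real_inner_smul_left, norm_smul, Real.norm_of_nonneg hc, this,
    Real.sqrt_mul (sq_nonneg c), Real.sqrt_sq hc]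

theorem continuous_gaugeRoot (κ : W) : Continuous (gaugeRoot κ) := by
  unfold gaugeRoot
  fun_prop

theorem gaugeRoot_pos {κ : W} (hκ : ‖κ‖ < 1) {w : W} (hw : w ≠ 0) : 0 < gaugeRoot κ w := by
  have hc := one_sub_norm_sq_pos hκ
  have : 0 < ‖w‖ := norm_pos_iff.2 hw
  exact Real.sqrt_pos.2 (by positivity)

theorem gauge_pos {κ : W} (hκ : ‖κ‖ < 1) {w : W} (hw : w ≠ 0) : 0 < gauge κ w := by
  refine lt_of_le_of_ne (gauge_nonneg hκ w) fun h => hw ?_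
  have := norm_sub_gauge hκ w
  rw [← h] at this
  simpa using this

theorem gaugeRoot_shear {κ : W} (hκ : ‖κ‖ < 1) (y : W) :
    gaugeRoot κ (shear κ y) = ‖y‖ + inner ℝ y κ := by
  rw [gaugeRoot_eq hκ, gauge_shear hκ, shear, inner_add_left, real_inner_smul_left,
    real_inner_self_eq_norm_sq]
  ring

theorem hasFDerivAt_shear (κ : W) {y : W} (hy : y ≠ 0) :
    HasFDerivAt (shear κ)
      (ContinuousLinearMap.id ℝ W + ContinuousLinearMap.smulRight (‖y‖⁻¹ • innerSL ℝ y) κ) y := by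
  have h1 : HasFDerivAt (fun y : W => ‖y‖ ^ 2) (2 • innerSL ℝ y) y :=
    (hasStrictFDerivAt_norm_sq y).hasFDerivAt
  have h2 : HasFDerivAt (fun y : W => ‖y‖) (‖y‖⁻¹ • innerSL ℝ y) y := by
    have h3 := h1.sqrt (by positivity)
    simp only [Real.sqrt_sq (norm_nonneg _)] at h3
    convert! h3 using 1
    ext w
    simp
    field_simp
  exact (hasFDerivAt_id y).add (h2.smul_const κ)

/-- The integrand on a half space from which both sides of `lintegral_toSphere_shift` are obtained
by integration along rays. -/
def coneIntegrand (κ ω : W) (F : W → ℝ≥0∞) (w : W) : ℝ≥0∞ :=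
  {w | 0 < inner ℝ w ω ∧ gauge κ w < 1}.indicator
    (fun w => ENNReal.ofReal (gauge κ w / gaugeRoot κ w) * F ((gauge κ w)⁻¹ • w)) w

/-- Numerator and denominator of the weight are homogeneous of degree one, so along a ray only the
cutoff depends on c. -/
theorem coneIntegrand_smul {κ ω : W} {F : W → ℝ≥0∞} {c : ℝ} (hc : 0 < c) {w : W}
    (hw : 0 < inner ℝ w ω) :
    coneIntegrand κ ω F (c • w) = (Iio 1).indicator
      (fun _ => ENNReal.ofReal (gauge κ w / gaugeRoot κ w) * F ((gauge κ w)⁻¹ • w))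
        (c * gauge κ w) := by
  have h1 : gauge κ (c • w) / gaugeRoot κ (c • w) = gauge κ w / gaugeRoot κ w := by
    rw [gauge_smul κ hc.le, gaugeRoot_smul κ hc.le, mul_div_mul_left _ _ hc.ne']
  have h2 : (gauge κ (c • w))⁻¹ • c • w = (gauge κ w)⁻¹ • w := by
    rw [gauge_smul κ hc.le, smul_smul, mul_inv]
    congr 1
    field_simp
  have h3 : 0 < inner ℝ (c • w) ω := by
    rw [real_inner_smul_left]; positivity
  simp only [coneIntegrand, indicator_apply, mem_ofPred_eq, h1, h2, h3, true_and, mem_Iio]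
  rw [gauge_smul κ hc.le]

/-- The derivative of the shear is a rank-one perturbation of the identity. -/
theorem det_shear [FiniteDimensional ℝ W] (κ : W) (y : W) :
    (ContinuousLinearMap.id ℝ W +
      ContinuousLinearMap.smulRight (‖y‖⁻¹ • innerSL ℝ y) κ).det = 1 + ‖y‖⁻¹ * inner ℝ y κ := by
  have := LinearMap.transvection.det ((‖y‖⁻¹ • innerSL ℝ y : W →L[ℝ] ℝ) : W →ₗ[ℝ] ℝ) κ
  rw [ContinuousLinearMap.det]
  convert! this using 1

theorem lintegral_pow_Ioo {c : ℝ} (hc : 0 ≤ c) (n : ℕ) :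
    ∫⁻ x in Ioo 0 c, ENNReal.ofReal (x ^ n) = ENNReal.ofReal (c ^ (n + 1) / (n + 1)) := by
  rw [Measure.restrict_congr_set Ioo_ae_eq_Ioc,
    ← ofReal_integral_eq_lintegral_ofReal (intervalIntegral.intervalIntegrable_pow _).1,
    ← intervalIntegral.integral_of_le hc]
  · simp
  · filter_upwards [ae_restrict_mem measurableSet_Ioc] with y hy
    exact pow_nonneg hy.1.le _

end Gauge

/-! ### Fubini along a hyperplane and its normal. -/

section Decomposition

variable {V W : Type*} [NormedAddCommGroup V] [InnerProductSpace ℝ V] [FiniteDimensional ℝ V]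
  [MeasurableSpace V] [BorelSpace V] [NormedAddCommGroup W] [InnerProductSpace ℝ W]
  [FiniteDimensional ℝ W] [MeasurableSpace W] [BorelSpace W]

/-- Orthogonal coordinates with respect to a hyperplane preserve Lebesgue measure. -/
theorem measurePreserving_add_smul (ι : V →ₗᵢ[ℝ] W) {ω : W} (hω : ‖ω‖ = 1)
    (hι : ∀ v, inner ℝ (ι v) ω = 0) (hd : Module.finrank ℝ W = Module.finrank ℝ V + 1) :
    MeasurePreserving (fun p : V × ℝ => ι p.1 + p.2 • ω)
      ((volume : Measure V).prod (volume : Measure ℝ)) (volume : Measure W) := by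
  let L : WithLp 2 (V × ℝ) →ₗ[ℝ] W :=
    { toFun := fun p => ι p.fst + p.snd • ω
      map_add' := fun p q => by simp [add_smul]; abel
      map_smul' := fun c p => by simp [smul_smul] }
  let J : WithLp 2 (V × ℝ) →ₗᵢ[ℝ] W :=
    { L with
      norm_map' := fun p => by
        rw [← sq_eq_sq₀ (norm_nonneg _) (norm_nonneg _), WithLp.prod_norm_sq_eq_of_L2]
        simpa using! norm_sq_add_smul ι hω hι p.fst p.snd }
  have hfin : Module.finrank ℝ (WithLp 2 (V × ℝ)) = Module.finrank ℝ W := by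
    rw [hd, (WithLp.linearEquiv 2 ℝ (V × ℝ)).finrank_eq]
    simp
  have h1 := (J.toLinearIsometryEquiv hfin).measurePreserving
  exact h1.comp (WithLp.volume_preserving_toLp V ℝ)

theorem lintegral_eq_lintegral_add_smul (ι : V →ₗᵢ[ℝ] W) {ω : W} (hω : ‖ω‖ = 1)
    (hι : ∀ v, inner ℝ (ι v) ω = 0) (hd : Module.finrank ℝ W = Module.finrank ℝ V + 1)
    {g : W → ℝ≥0∞} (hg : Measurable g) :
    ∫⁻ w, g w = ∫⁻ t : ℝ, ∫⁻ v : V, g (ι v + t • ω) := by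
  have h := measurePreserving_add_smul ι hω hι hd
  rw [← h.lintegral_comp hg, lintegral_prod_symm]
  exact (hg.comp h.measurable).aemeasurable

end Decomposition

/-! ### Polar coordinates and the change of variables by the shear. -/

section Polar

variable {W : Type*} [NormedAddCommGroup W] [InnerProductSpace ℝ W]
  [FiniteDimensional ℝ W] [MeasurableSpace W] [BorelSpace W]

theorem lintegral_polar [Nontrivial W] {g : W → ℝ≥0∞} (hg : Measurable g) :
    ∫⁻ w, g w = ∫⁻ u, (∫⁻ ρ in Ioi (0 : ℝ),
      ENNReal.ofReal (ρ ^ (Module.finrank ℝ W - 1)) * g (ρ • (u : W)))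
      ∂(volume : Measure W).toSphere := by
  have h := (volume : Measure W).measurePreserving_homeomorphUnitSphereProd
  have h2 := MeasurePreserving.symm (homeomorphUnitSphereProd W).toMeasurableEquiv h
  have h3 := h2.lintegral_comp (f := fun w : ({0}ᶜ : Set W) => g w)
    (hg.comp measurable_subtype_coe)
  rw [lintegral_subtype_comap (measurableSet_singleton _).compl, restrict_compl_singleton] at h3
  rw [← h3, lintegral_prod]
  · refine lintegral_congr fun u => ?_
    rw [Measure.volumeIoiPow, lintegral_withDensity_eq_lintegral_mul₀]
    · rw [← lintegral_subtype_comap measurableSet_Ioi]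
      rfl
    · fun_prop
    · refine (hg.comp (measurable_subtype_coe.comp ?_)).aemeasurable
      exact (MeasurableEquiv.measurable _).comp measurable_prodMk_left
  · exact (hg.comp (measurable_subtype_coe.comp (MeasurableEquiv.measurable _))).aemeasurable

/-- The shear is a bijection fixing 0 and differentiable elsewhere; its Jacobian is nonnegative
because ‖κ‖ < 1. -/
theorem lintegral_shear [Nontrivial W] {κ : W} (hκ : ‖κ‖ < 1) {g : W → ℝ≥0∞} :
    ∫⁻ w, g w = ∫⁻ y, ENNReal.ofReal (1 + ‖y‖⁻¹ * inner ℝ y κ) * g (shear κ y) := by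
  have h := lintegral_image_eq_lintegral_abs_det_fderiv_mul (volume : Measure W)
    (s := {0}ᶜ) (f := shear κ) (measurableSet_singleton _).compl
    (fun y hy => (hasFDerivAt_shear κ hy).hasFDerivWithinAt) (shear_injective hκ).injOn g
  have himg : shear κ '' {0}ᶜ = {0}ᶜ := by
    rw [image_compl_eq ⟨shear_injective hκ, fun w => ⟨_, shear_sub_gauge hκ w⟩⟩]
    simp [shear]
  rw [himg, restrict_compl_singleton] at h
  rw [h]
  refine lintegral_congr fun y => ?_
  rw [det_shear, abs_of_nonneg]
  by_cases hy : y = 0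
  · simp [hy]
  · have := neg_norm_le_inner hκ y
    have hy' : 0 < ‖y‖ := norm_pos_iff.2 hy
    rw [← mul_inv_cancel₀ hy'.ne', mul_comm ‖y‖, ← mul_add]
    exact mul_nonneg (by positivity) (by linarith)

end Polar

/-! ### Central projection of a displaced half sphere to a hyperplane. -/

section Shift

variable {V W : Type*} [NormedAddCommGroup V] [InnerProductSpace ℝ V] [FiniteDimensional ℝ V]
  [MeasurableSpace V] [BorelSpace V] [NormedAddCommGroup W] [InnerProductSpace ℝ W]
  [FiniteDimensional ℝ W] [MeasurableSpace W] [BorelSpace W]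

theorem lintegral_eq_lintegral_comp_smul {c : ℝ} (hc : 0 < c) {f : V → ℝ≥0∞} (hf : Measurable f) :
    ∫⁻ v, f v = ENNReal.ofReal (c ^ Module.finrank ℝ V) * ∫⁻ v, f (c • v) := by
  have h := Measure.map_addHaar_smul (volume : Measure V) hc.ne'
  rw [← lintegral_map hf (measurable_const_smul c), h, lintegral_smul_measure, smul_eq_mul,
    ← mul_assoc, ← ENNReal.ofReal_mul (by positivity), abs_of_pos (by positivity),
    mul_inv_cancel₀ (by positivity)]
  simp

theorem measurable_coneIntegrand (κ ω : W) {F : W → ℝ≥0∞} (hF : Measurable F) :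
    Measurable (coneIntegrand κ ω F) := by
  have h1 := (continuous_gauge κ).measurable
  have h2 := (continuous_gaugeRoot κ).measurable
  refine Measurable.indicator ?_ ?_
  · exact (h1.div h2).ennreal_ofReal.mul (hF.comp (h1.inv.smul measurable_id))
  · exact (measurableSet_lt measurable_const (Measurable.inner_const (𝕜 := ℝ) measurable_id)).inter
      (measurableSet_lt h1 measurable_const)

/-- At `shear κ y` the weight gauge / gaugeRoot equals ‖y‖ / (‖y‖ + y · κ), the inverse of the
Jacobian of the shear. What remains in polar coordinates is constant on each ray up to ρ = 1, and 1
/ (m + 1) is the integral of ρ^m over (0, 1). -/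
theorem lintegral_coneIntegrand_sphere [Nontrivial W] {κ : W} (hκ : ‖κ‖ < 1) (ω : W)
    {F : W → ℝ≥0∞} (hF : Measurable F) {m : ℕ} (hd : Module.finrank ℝ W = m + 1) :
    ∫⁻ w, coneIntegrand κ ω F w = ENNReal.ofReal (1 / (m + 1)) *
      ∫⁻ u, {w | 0 < inner ℝ w ω}.indicator F ((u : W) + κ) ∂(volume : Measure W).toSphere := by
  have hm := measurable_coneIntegrand κ ω hF
  rw [lintegral_shear hκ, lintegral_polar, ← lintegral_const_mul]
  · refine lintegral_congr fun u => ?_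
    have hu : ‖(u : W)‖ = 1 := by simp
    have hpos : 0 < 1 + inner ℝ (u : W) κ := by
      have h := abs_le.1 (abs_real_inner_le_norm (u : W) κ)
      rw [hu, one_mul] at h
      linarith [h.1]
    have key : ∀ ρ ∈ Ioi (0 : ℝ), ENNReal.ofReal (ρ ^ (Module.finrank ℝ W - 1)) *
        (ENNReal.ofReal (1 + ‖ρ • (u : W)‖⁻¹ * inner ℝ (ρ • (u : W)) κ) *
          coneIntegrand κ ω F (shear κ (ρ • (u : W)))) =
        (Iio 1).indicator (fun ρ => ENNReal.ofReal (ρ ^ m) *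
          {w | 0 < inner ℝ w ω}.indicator F ((u : W) + κ)) ρ := by
      intro ρ hρ
      have hρ : 0 < ρ := hρ
      have hs : shear κ (ρ • (u : W)) = ρ • shear κ (u : W) := by
        simp [shear, norm_smul, abs_of_pos hρ, hu]
      have hs1 : shear κ (u : W) = u + κ := by simp [shear, hu]
      have hn : ‖ρ • (u : W)‖⁻¹ * inner ℝ (ρ • (u : W)) κ = inner ℝ (u : W) κ := by
        rw [real_inner_smul_left, norm_smul, hu, Real.norm_of_nonneg hρ.le]
        field_simp
      rw [hn, hs, hd, Nat.add_sub_cancel]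
      by_cases hH : 0 < inner ℝ ((u : W) + κ) ω
      · rw [coneIntegrand_smul hρ (by rwa [hs1]), gauge_shear hκ, gaugeRoot_shear hκ, hu, mul_one,
          indicator_of_mem (s := {w | 0 < inner ℝ w ω}) hH, hs1]
        by_cases h1 : ρ ∈ Iio 1
        · rw [indicator_of_mem h1, indicator_of_mem h1, ← mul_assoc (ENNReal.ofReal (1 + _)),
            ← ENNReal.ofReal_mul hpos.le, mul_one_div_cancel hpos.ne']
          simp
        · rw [indicator_of_notMem h1, indicator_of_notMem h1]
          simp
      · rw [coneIntegrand, indicator_of_notMem, indicator_of_notMem (s := {w | 0 < inner ℝ w ω}) hH]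
        · simp
        · rintro ⟨h, -⟩
          rw [hs1, real_inner_smul_left] at h
          exact hH (pos_of_mul_pos_right h hρ.le)
    rw [setLIntegral_congr_fun measurableSet_Ioi key, lintegral_indicator measurableSet_Iio,
      Measure.restrict_restrict measurableSet_Iio, lintegral_mul_const _ (by fun_prop),
      inter_comm, Ioi_inter_Iio, lintegral_pow_Ioo zero_le_one, one_pow]
  · exact (hF.indicator (measurableSet_lt measurable_const (by fun_prop))).comp (by fun_prop)
  · exact Measurable.mul (by fun_prop) (hm.comp (continuous_shear κ).measurable)

/-- Rescaling the layer at height t to the layer at height h costs (t / h)^m and puts the points of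
one ray over the same v. With N the gauge at height h, the cutoff is t < h / N, and integrating t^m
up to there gives (h / N)^(m + 1) / (m + 1). -/
theorem lintegral_coneIntegrand_hyperplane (ι : V →ₗᵢ[ℝ] W) {ω : W} (hω : ‖ω‖ = 1)
    (hι : ∀ v, inner ℝ (ι v) ω = 0) (hd : Module.finrank ℝ W = Module.finrank ℝ V + 1)
    {κ : W} (hκ : ‖κ‖ < 1) {h : ℝ} (hh : 0 < h) {F : W → ℝ≥0∞} (hF : Measurable F) {m : ℕ}
    (hm : Module.finrank ℝ V = m) :
    ∫⁻ w, coneIntegrand κ ω F w = ENNReal.ofReal (1 / (m + 1)) *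
      ∫⁻ v : V, ENNReal.ofReal
        (h / (gauge κ (ι v + h • ω) ^ m * gaugeRoot κ (ι v + h • ω))) *
          F ((gauge κ (ι v + h • ω))⁻¹ • (ι v + h • ω)) := by
  have hmeas := measurable_coneIntegrand κ ω hF
  have hin : ∀ v : V, ∀ t : ℝ, inner ℝ (ι v + t • ω) ω = t := by
    intro v t
    rw [inner_add_left, hι, real_inner_smul_left, real_inner_self_eq_norm_sq, hω]
    simp
  have hz : ∀ v : V, ι v + h • ω ≠ 0 := by
    intro v h0
    have := hin v h
    rw [h0, inner_zero_left] at this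
    exact hh.ne this
  have hzm : Measurable fun v : V => ι v + h • ω := by
    have := ι.continuous.measurable
    fun_prop
  have hg := (continuous_gauge κ).measurable.comp hzm
  have hgr := (continuous_gaugeRoot κ).measurable.comp hzm
  simp only [Function.comp_def] at hg hgr
  have hsupp : Function.support (fun t : ℝ => ∫⁻ v : V, coneIntegrand κ ω F (ι v + t • ω)) ⊆
      Ioi 0 := by
    intro t ht
    by_contra hneg
    refine ht ?_
    simp only [coneIntegrand]
    refine (lintegral_congr fun v => indicator_of_notMem ?_ _).trans lintegral_zero
    rintro ⟨h1, -⟩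
    rw [hin] at h1
    exact hneg h1
  rw [lintegral_eq_lintegral_add_smul ι hω hι hd hmeas, ← setLIntegral_eq_of_support_subset hsupp]
  have key : ∀ t ∈ Ioi (0 : ℝ), ∫⁻ v : V, coneIntegrand κ ω F (ι v + t • ω) =
      ∫⁻ v : V, ENNReal.ofReal ((t / h) ^ m) *
        coneIntegrand κ ω F ((t / h) • (ι v + h • ω)) := by
    intro t ht
    have ht : 0 < t := ht
    rw [lintegral_eq_lintegral_comp_smul (c := t / h) (by positivity) (by
      have := ι.continuous.measurable
      exact hmeas.comp (by fun_prop)), hm]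
    rw [lintegral_const_mul]
    · simp only [map_smul, smul_add, smul_smul, div_mul_cancel₀ _ hh.ne']
    · exact hmeas.comp (by fun_prop)
  rw [setLIntegral_congr_fun measurableSet_Ioi key, lintegral_lintegral_swap,
    ← lintegral_const_mul]
  · refine lintegral_congr fun v => ?_
    have hN := gauge_pos hκ (hz v)
    have hS := gaugeRoot_pos hκ (hz v)
    have key' : ∀ t ∈ Ioi (0 : ℝ), ENNReal.ofReal ((t / h) ^ m) *
        coneIntegrand κ ω F ((t / h) • (ι v + h • ω)) =
        (Iio (h / gauge κ (ι v + h • ω))).indicator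
          (fun t => ENNReal.ofReal (h⁻¹ ^ m) * ENNReal.ofReal (t ^ m) * (ENNReal.ofReal
            (gauge κ (ι v + h • ω) / gaugeRoot κ (ι v + h • ω)) *
              F ((gauge κ (ι v + h • ω))⁻¹ • (ι v + h • ω)))) t := by
      intro t ht
      have ht : 0 < t := ht
      rw [coneIntegrand_smul (by positivity) (by rwa [hin])]
      have hiff : t / h * gauge κ (ι v + h • ω) ∈ Iio (1 : ℝ) ↔
          t ∈ Iio (h / gauge κ (ι v + h • ω)) := by
        rw [mem_Iio, mem_Iio, lt_div_iff₀ hN, div_mul_eq_mul_div, div_lt_one hh]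
      by_cases h1 : t ∈ Iio (h / gauge κ (ι v + h • ω))
      · rw [indicator_of_mem h1, indicator_of_mem (hiff.2 h1),
          ← ENNReal.ofReal_mul (by positivity : 0 ≤ h⁻¹ ^ m), ← mul_pow, inv_mul_eq_div]
      · rw [indicator_of_notMem h1, indicator_of_notMem (mt hiff.1 h1), mul_zero]
    rw [setLIntegral_congr_fun measurableSet_Ioi key',
      lintegral_indicator measurableSet_Iio, Measure.restrict_restrict measurableSet_Iio,
      inter_comm, Ioi_inter_Iio, lintegral_mul_const _ (by fun_prop),
      lintegral_const_mul _ (by fun_prop), lintegral_pow_Ioo (by positivity), ← mul_assoc,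
      ← mul_assoc, ← ENNReal.ofReal_mul (by positivity), ← ENNReal.ofReal_mul (by positivity),
      ← ENNReal.ofReal_mul (by positivity)]
    congr 2
    rw [pow_succ, div_pow, inv_pow]
    field_simp
  · exact Measurable.mul (by fun_prop) (hF.comp (hg.inv.smul hzm))
  · have := ι.continuous.measurable
    refine (Measurable.mul (by fun_prop) (hmeas.comp ?_)).aemeasurable
    fun_prop

/-- Integration over a half of a sphere of radius one with center `κ`, expressed by central
projection from the interior point `0` to a hyperplane at distance `h` from `0`. -/
theorem lintegral_toSphere_shift (ι : V →ₗᵢ[ℝ] W) {ω : W} (hω : ‖ω‖ = 1)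
    (hι : ∀ v, inner ℝ (ι v) ω = 0) (hd : Module.finrank ℝ W = Module.finrank ℝ V + 1)
    {κ : W} (hκ : ‖κ‖ < 1) {h : ℝ} (hh : 0 < h) {F : W → ℝ≥0∞} (hF : Measurable F) {m : ℕ}
    (hm : Module.finrank ℝ V = m) :
    ∫⁻ u, {w | 0 < inner ℝ w ω}.indicator F ((u : W) + κ) ∂(volume : Measure W).toSphere =
      ∫⁻ v : V, ENNReal.ofReal
        (h / (gauge κ (ι v + h • ω) ^ m * gaugeRoot κ (ι v + h • ω))) *
          F ((gauge κ (ι v + h • ω))⁻¹ • (ι v + h • ω)) := by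
  have : Nontrivial W := Module.nontrivial_of_finrank_pos (R := ℝ) (by omega)
  have h1 := lintegral_coneIntegrand_sphere hκ ω hF (hm ▸ hd)
  rw [lintegral_coneIntegrand_hyperplane ι hω hι hd hκ hh hF hm] at h1
  refine ((ENNReal.mul_right_inj ?_ ENNReal.ofReal_ne_top).1 h1).symm
  rw [Ne, ENNReal.ofReal_eq_zero, not_le]
  positivity

end Shift

/-! ### Splitting ℝⁿ⁺¹ into horizontal part and height. -/

section Coordinates

variable {n : ℕ}

@[simp]
theorem horiz_join (x : EuclideanSpace ℝ (Fin n)) (y : ℝ) : horiz (join x y) = x := by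
  ext i; simp [horiz, join]

@[simp]
theorem height_join (x : EuclideanSpace ℝ (Fin n)) (y : ℝ) : height (join x y) = y := by
  simp [height, join]

@[simp]
theorem join_horiz_height (η : EuclideanSpace ℝ (Fin (n + 1))) : join (horiz η) (height η) = η := by
  ext i
  refine Fin.lastCases ?_ (fun i => ?_) i <;> simp [horiz, join, height]

theorem join_add (x x' : EuclideanSpace ℝ (Fin n)) (y y' : ℝ) :
    join (x + x') (y + y') = join x y + join x' y' := by
  ext i
  refine Fin.lastCases ?_ (fun i => ?_) i <;> simp [join]

theorem join_smul (c : ℝ) (x : EuclideanSpace ℝ (Fin n)) (y : ℝ) :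
    join (c • x) (c * y) = c • join x y := by
  ext i
  refine Fin.lastCases ?_ (fun i => ?_) i <;> simp [join]

theorem inner_join (x x' : EuclideanSpace ℝ (Fin n)) (y y' : ℝ) :
    inner ℝ (join x y) (join x' y') = inner ℝ x x' + y * y' := by
  simp [PiLp.inner_apply, Fin.sum_univ_castSucc, join, mul_comm]

theorem norm_sq_join (x : EuclideanSpace ℝ (Fin n)) (y : ℝ) :
    ‖join x y‖ ^ 2 = ‖x‖ ^ 2 + y ^ 2 := by
  rw [← real_inner_self_eq_norm_sq, inner_join, real_inner_self_eq_norm_sq, sq y]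

/-- The isometric embedding of `ℝⁿ` into `ℝⁿ⁺¹` as a coordinate hyperplane. -/
def inclusion (n : ℕ) : EuclideanSpace ℝ (Fin n) →ₗᵢ[ℝ] EuclideanSpace ℝ (Fin (n + 1)) where
  toFun x := join x 0
  map_add' x x' := by simp [← join_add]
  map_smul' c x := by simp [← join_smul]
  norm_map' x := by
    rw [← sq_eq_sq₀ (norm_nonneg _) (norm_nonneg _)]
    exact (norm_sq_join x 0).trans (by simp)

/-- The last standard basis vector of `ℝⁿ⁺¹`. -/
def pole (n : ℕ) : EuclideanSpace ℝ (Fin (n + 1)) := join 0 1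

theorem inclusion_apply (x : EuclideanSpace ℝ (Fin n)) : inclusion n x = join x 0 := rfl

theorem join_eq (x : EuclideanSpace ℝ (Fin n)) (y : ℝ) :
    join x y = inclusion n x + y • pole n := by
  rw [inclusion_apply, pole, ← join_smul, ← join_add]
  simp

theorem continuous_join : Continuous fun p : EuclideanSpace ℝ (Fin n) × ℝ => join p.1 p.2 := by
  simp only [join_eq]
  have := (inclusion n).continuous
  fun_prop

theorem continuous_height : Continuous (height : EuclideanSpace ℝ (Fin (n + 1)) → ℝ) := by
  unfold height
  fun_prop

theorem continuous_horiz :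
    Continuous (horiz : EuclideanSpace ℝ (Fin (n + 1)) → EuclideanSpace ℝ (Fin n)) := by
  unfold horiz
  fun_prop

theorem norm_pole : ‖pole n‖ = 1 := by
  have := norm_sq_join (0 : EuclideanSpace ℝ (Fin n)) 1
  rw [← sq_eq_sq₀ (norm_nonneg _) zero_le_one]
  simpa [pole] using this

theorem inner_pole (η : EuclideanSpace ℝ (Fin (n + 1))) : inner ℝ η (pole n) = height η := by
  rw [← join_horiz_height η, pole, inner_join]
  simp

theorem inner_inclusion_pole (x : EuclideanSpace ℝ (Fin n)) :
    inner ℝ (inclusion n x) (pole n) = 0 := by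
  simp [inner_pole, inclusion_apply]

theorem measurePreserving_join :
    MeasurePreserving (fun p : EuclideanSpace ℝ (Fin n) × ℝ => join p.1 p.2) := by
  have := measurePreserving_add_smul (inclusion n) norm_pole inner_inclusion_pole (by simp)
  simpa only [join_eq] using! this

end Coordinates

/-! ### The modified stereographic projection and its gauge. -/

section Projection

variable {n : ℕ} {a : ℝ}

theorem D_sq (ha : -1 < a) (ha' : a < 1) (x : EuclideanSpace ℝ (Fin n)) :
    D a x ^ 2 = (a + 1) * (‖x‖ ^ 2 * (1 - a) + a + 1) := by
  have : 0 ≤ ‖x‖ ^ 2 * (1 - a) := mul_nonneg (sq_nonneg _) (by linarith)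
  rw [D, mul_pow, Real.sq_sqrt (by linarith), Real.sq_sqrt (by linarith)]

theorem add_one_le_D (ha : -1 < a) (ha' : a < 1) (x : EuclideanSpace ℝ (Fin n)) :
    a + 1 ≤ D a x := by
  have h := D_sq ha ha' x
  have h0 : 0 ≤ D a x := by unfold D; positivity
  have : 0 ≤ ‖x‖ ^ 2 * (1 - a) := mul_nonneg (sq_nonneg _) (by linarith)
  nlinarith

theorem D_pos (ha : -1 < a) (ha' : a < 1) (x : EuclideanSpace ℝ (Fin n)) : 0 < D a x := by
  linarith [add_one_le_D ha ha' x]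

theorem P_pos (ha : -1 < a) (ha' : a < 1) (x : EuclideanSpace ℝ (Fin n)) : 0 < P a x := by
  have h := add_one_le_D ha ha' x
  have h1 : 0 < a + 1 := by linarith
  refine div_pos ?_ (by positivity)
  nlinarith

theorem Q_eq (ha : -1 < a) (x : EuclideanSpace ℝ (Fin n)) : Q a x = a - (a + 1) * P a x := by
  have h1 : 0 < a + 1 := by linarith
  rw [Q, P]
  field_simp
  ring

/-- Multiplying by the conjugate, D² - a²(a + 1)² = (1 - a²)(‖x‖² + (a + 1)²). -/
theorem mul_P (ha : -1 < a) (ha' : a < 1) (x : EuclideanSpace ℝ (Fin n)) :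
    (D a x - a * (a + 1)) * P a x = 1 - a ^ 2 := by
  have h1 : 0 < a + 1 := by linarith
  have h := D_sq ha ha' x
  rw [P, ← mul_div_assoc, div_eq_iff (by positivity)]
  linear_combination h

/-- Exhibits π(x) on the ray from a e through x - e; P is the parameter on that ray. -/
theorem proj_eq (ha : -1 < a) (x : EuclideanSpace ℝ (Fin n)) :
    proj a x = a • pole n + P a x • (inclusion n x - (a + 1) • pole n) := by
  rw [proj, join_eq, Q_eq ha, map_smul]
  module

theorem continuous_D : Continuous (D a : EuclideanSpace ℝ (Fin n) → ℝ) := by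
  unfold D; fun_prop

theorem continuous_P (ha : -1 < a) : Continuous (P a : EuclideanSpace ℝ (Fin n) → ℝ) := by
  have h1 : 0 < a + 1 := by linarith
  have := continuous_D (n := n) (a := a)
  unfold P
  refine Continuous.div (by fun_prop) (by fun_prop) fun x => by positivity

theorem continuous_proj (ha : -1 < a) :
    Continuous (proj a : EuclideanSpace ℝ (Fin n) → EuclideanSpace ℝ (Fin (n + 1))) := by
  have := continuous_P (n := n) ha
  have := (inclusion n).continuous
  simp only [funext (proj_eq ha)]
  fun_prop

theorem proj_injective (ha : -1 < a) (ha' : a < 1) :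
    Function.Injective (proj a : EuclideanSpace ℝ (Fin n) → EuclideanSpace ℝ (Fin (n + 1))) := by
  intro x x' h
  have h1 : 0 < a + 1 := by linarith
  have hQ := congrArg height h
  have hx := congrArg horiz h
  simp only [proj, height_join, horiz_join, Q_eq ha] at hQ hx
  have hP : P a x = P a x' := by nlinarith
  rw [hP] at hx
  exact smul_right_injective _ (P_pos ha ha' x').ne' hx

variable {W : Type*} [NormedAddCommGroup W] [InnerProductSpace ℝ W]

/-- Here q leads from a e to the center of a sphere of radius r, and z from a e to x - e. The
quantity r² - ‖q‖² is minus the power of a e, which has the same value 1 - a² for Sⁿ and for every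
slice; so both cases are covered at once. -/
theorem gaugeRoot_inv_smul (ha : -1 < a) (ha' : a < 1) {q z : W} {r : ℝ} (hr : 0 < r)
    {x : EuclideanSpace ℝ (Fin n)} (hq : r ^ 2 - ‖q‖ ^ 2 = 1 - a ^ 2)
    (hzq : inner ℝ z q = a * (a + 1)) (hz : ‖z‖ ^ 2 = ‖x‖ ^ 2 + (a + 1) ^ 2) :
    gaugeRoot (r⁻¹ • q) z = D a x / r := by
  rw [gaugeRoot, Real.sqrt_eq_iff_mul_self_eq_of_pos (div_pos (D_pos ha ha' x) hr),
    real_inner_smul_right, norm_smul, hzq, hz, ← sq, div_pow, D_sq ha ha', norm_inv,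
    Real.norm_of_nonneg hr.le, mul_pow]
  field_simp
  linear_combination -(‖x‖ ^ 2 + (a + 1) ^ 2) * hq

theorem gauge_inv_smul (ha : -1 < a) (ha' : a < 1) {q z : W} {r : ℝ} (hr : 0 < r)
    {x : EuclideanSpace ℝ (Fin n)} (hq : r ^ 2 - ‖q‖ ^ 2 = 1 - a ^ 2)
    (hzq : inner ℝ z q = a * (a + 1)) (hz : ‖z‖ ^ 2 = ‖x‖ ^ 2 + (a + 1) ^ 2) :
    gauge (r⁻¹ • q) z = r / P a x := by
  have hP := P_pos ha ha' x
  have h1 : 0 < 1 - a ^ 2 := by nlinarith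
  have h2 : 1 - ‖r⁻¹ • q‖ ^ 2 = (1 - a ^ 2) / r ^ 2 := by
    rw [norm_smul, norm_inv, Real.norm_of_nonneg hr.le, ← hq]
    field_simp
  rw [gauge_eq, gaugeRoot_inv_smul ha ha' hr hq hzq hz, h2, real_inner_smul_right, hzq,
    div_eq_div_iff (by positivity) hP.ne']
  have := mul_P ha ha' x
  field_simp
  linear_combination this

theorem norm_inv_smul_lt_one (ha : -1 < a) (ha' : a < 1) {q : W} {r : ℝ} (hr : 0 < r)
    (hq : r ^ 2 - ‖q‖ ^ 2 = 1 - a ^ 2) : ‖r⁻¹ • q‖ < 1 := by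
  have h1 : 0 < 1 - a ^ 2 := by nlinarith
  rw [norm_smul, norm_inv, Real.norm_of_nonneg hr.le, inv_mul_lt_one₀ hr]
  exact lt_of_pow_lt_pow_left₀ 2 hr.le (by linarith)

end Projection

/-! ### Surface measure of the truncated sphere in projected coordinates. -/

section SphereIntegral

variable {n : ℕ} {a : ℝ}

theorem measurableSet_truncSphere : MeasurableSet (truncSphere n a) :=
  (isClosed_sphere.measurableSet).inter
    (measurableSet_lt continuous_height.measurable measurable_const)

/-- The truncated sphere in the coordinates of the modified stereographic projection. -/
theorem setLIntegral_truncSphere (ha : -1 < a) (ha' : a < 1)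
    {F : EuclideanSpace ℝ (Fin (n + 1)) → ℝ≥0∞} (hF : Measurable F) :
    ∫⁻ η in truncSphere n a, F η ∂(sphereMeasure n) =
      ∫⁻ x : EuclideanSpace ℝ (Fin n),
        ENNReal.ofReal ((a + 1) * P a x ^ n / D a x) * F (proj a x) := by
  have h1 : 0 < a + 1 := by linarith
  have hz : ∀ x : EuclideanSpace ℝ (Fin n), inclusion n x + (a + 1) • -pole n =
      inclusion n x - (a + 1) • pole n := fun x => by module
  have hq : (1 : ℝ) ^ 2 - ‖-a • pole n‖ ^ 2 = 1 - a ^ 2 := by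
    rw [norm_smul, norm_pole]; simp
  have hzq : ∀ x : EuclideanSpace ℝ (Fin n),
      inner ℝ (inclusion n x + (a + 1) • -pole n) (-a • pole n) = a * (a + 1) := fun x => by
    rw [inner_add_left, real_inner_smul_right, inner_inclusion_pole, real_inner_smul_right,
      real_inner_smul_left, inner_neg_left, real_inner_self_eq_norm_sq, norm_pole]
    ring
  have hzn : ∀ x : EuclideanSpace ℝ (Fin n),
      ‖inclusion n x + (a + 1) • -pole n‖ ^ 2 = ‖x‖ ^ 2 + (a + 1) ^ 2 := fun x =>
    norm_sq_add_smul (inclusion n) (by rw [norm_neg, norm_pole])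
      (fun v => by rw [inner_neg_right, inner_inclusion_pole, neg_zero]) x (a + 1)
  -- The origin is moved to a e: the center becomes -a e, the half space points downwards, and the
  -- plane at height -1 is at distance a + 1.
  have key := lintegral_toSphere_shift (inclusion n) (ω := -pole n) (by rw [norm_neg, norm_pole])
    (fun v => by rw [inner_neg_right, inner_inclusion_pole, neg_zero]) (by simp)
    (norm_inv_smul_lt_one ha ha' one_pos hq) h1
    (F := fun w => F (w + a • pole n)) (by fun_prop) (m := n) (by simp)
  have htrunc : MeasurableSet (truncSphere n a) := measurableSet_truncSphere
  rw [← lintegral_indicator htrunc, sphereMeasure,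
    lintegral_map (hF.indicator htrunc) measurable_subtype_coe]
  refine Eq.trans (lintegral_congr fun u => ?_) (key.trans (lintegral_congr fun x => ?_))
  · have hiff : (u : EuclideanSpace ℝ (Fin (n + 1))) ∈ truncSphere n a ↔
        (u : EuclideanSpace ℝ (Fin (n + 1))) + (1 : ℝ)⁻¹ • -a • pole n ∈
          {w | 0 < inner ℝ w (-pole n)} := by
      have : inner ℝ ((u : EuclideanSpace ℝ (Fin (n + 1))) + (1 : ℝ)⁻¹ • -a • pole n) (-pole n) =
          a - height (u : EuclideanSpace ℝ (Fin (n + 1))) := by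
        rw [inner_neg_right, inner_add_left, inner_pole, real_inner_smul_left,
          real_inner_smul_left, real_inner_self_eq_norm_sq, norm_pole]
        ring
      rw [mem_ofPred_eq, this, sub_pos]
      exact and_iff_right u.2
    by_cases hu : (u : EuclideanSpace ℝ (Fin (n + 1))) ∈ truncSphere n a
    · rw [indicator_of_mem hu, indicator_of_mem (hiff.1 hu)]
      congr 1
      module
    · rw [indicator_of_notMem hu, indicator_of_notMem (mt hiff.2 hu)]
  · have hP := P_pos ha ha' x
    have hD := D_pos ha ha' x
    rw [gaugeRoot_inv_smul ha ha' one_pos hq (hzq x) (hzn x),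
      gauge_inv_smul ha ha' one_pos hq (hzq x) (hzn x)]
    congr 2
    · rw [one_div, inv_pow]
      field_simp
    · rw [proj_eq ha, hz]
      simp only [one_div, inv_inv]
      module

end SphereIntegral

/-! ### Integration against the measure of a round sphere. -/

section RoundSphere

variable {E : Type*} [NormedAddCommGroup E] [InnerProductSpace ℝ E]
    [FiniteDimensional ℝ E] [MeasurableSpace E] [BorelSpace E]

theorem lintegral_roundSphereMeasure (W : Submodule ℝ E) (c : E) (r : ℝ) {F : E → ℝ≥0∞}
    (hF : Measurable F) :
    ∫⁻ η, F η ∂(roundSphereMeasure W c r) = ENNReal.ofReal (r ^ (Module.finrank ℝ W - 1)) *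
      ∫⁻ u, F (c + r • ((u : W) : E))
        ∂(@volume W measureSpaceOfInnerProductSpace).toSphere := by
  rw [roundSphereMeasure, lintegral_smul_measure, lintegral_map hF (by fun_prop), smul_eq_mul]

end RoundSphere

/-! ### Slices as images of hyperplanes, and the pointwise identity. -/

section Slice

variable {n : ℕ} {a s : ℝ}

theorem measurableSet_slice (ξ : EuclideanSpace ℝ (Fin (n + 1))) : MeasurableSet (slice a ξ) :=
  measurableSet_truncSphere.inter
    (measurableSet_eq_fun (by fun_prop) measurable_const)

/-- This is `lintegral_toSphere_shift` inside ξ^⊥, with hyperplane θ^⊥ and origin moved to a e. -/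
theorem setLIntegral_slice (hn : 2 ≤ n) (ha : -1 < a) (ha' : a < 1) (hs : s ^ 2 < 1)
    {θ : EuclideanSpace ℝ (Fin n)} (hθ : ‖θ‖ = 1) {F : EuclideanSpace ℝ (Fin (n + 1)) → ℝ≥0∞}
    (hF : Measurable F) :
    ∫⁻ η in slice a (join (Real.sqrt (1 - s ^ 2) • θ) s), F η
        ∂(sliceMeasure a (join (Real.sqrt (1 - s ^ 2) • θ) s)) =
      ∫⁻ u, ENNReal.ofReal (Real.sqrt ((1 - a ^ 2 * s ^ 2) / (1 - s ^ 2)) * ((a + 1) *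
          P a (((a + 1) * s / Real.sqrt (1 - s ^ 2)) • θ + (u : EuclideanSpace ℝ (Fin n))) ^ (n - 1)
          / D a (((a + 1) * s / Real.sqrt (1 - s ^ 2)) • θ + (u : EuclideanSpace ℝ (Fin n))))) *
        F (proj a (((a + 1) * s / Real.sqrt (1 - s ^ 2)) • θ + (u : EuclideanSpace ℝ (Fin n))))
        ∂(perpMeasure θ) := by
  have h1 : 0 < a + 1 := by linarith
  set b := Real.sqrt (1 - s ^ 2) with hb
  have hb0 : 0 < b := Real.sqrt_pos.2 (by linarith)
  have hb2 : b ^ 2 = 1 - s ^ 2 := Real.sq_sqrt (by linarith)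
  set ξ := join (b • θ) s with hξ
  have hξ1 : ‖ξ‖ = 1 := by
    rw [← sq_eq_sq₀ (norm_nonneg _) zero_le_one, norm_sq_join, norm_smul, hθ,
      Real.norm_of_nonneg hb0.le]
    linarith
  set r := Real.sqrt (1 - a ^ 2 * s ^ 2) with hr
  have has : a ^ 2 * s ^ 2 < 1 := by nlinarith [sq_nonneg a, sq_nonneg s]
  have hr0 : 0 < r := Real.sqrt_pos.2 (by linarith)
  have hr2 : r ^ 2 = 1 - a ^ 2 * s ^ 2 := Real.sq_sqrt (by linarith)
  have hheight : height ξ = s := height_join _ _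
  have hinclξ : ∀ x, inner ℝ ξ (inclusion n x) = b * inner ℝ θ x := fun x => by
    rw [hξ, inclusion_apply, inner_join, real_inner_smul_left]; ring
  have hpoleξ : inner ℝ ξ (pole n) = s := by rw [inner_pole, hheight]
  let W : Submodule ℝ (EuclideanSpace ℝ (Fin (n + 1))) := (Submodule.span ℝ {ξ})ᗮ
  have hW : ∀ w, w ∈ W ↔ inner ℝ ξ w = 0 := fun w =>
    Submodule.mem_orthogonal_singleton_iff_inner_right
  let V : Submodule ℝ (EuclideanSpace ℝ (Fin n)) := (Submodule.span ℝ {θ})ᗮ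
  have hV : ∀ u : V, inner ℝ θ (u : EuclideanSpace ℝ (Fin n)) = 0 := fun u =>
    Submodule.mem_orthogonal_singleton_iff_inner_right.1 u.2
  have hfW : Module.finrank ℝ W = n := by
    have := Fact.mk (show Module.finrank ℝ (EuclideanSpace ℝ (Fin (n + 1))) = n + 1 by simp)
    exact Submodule.finrank_orthogonal_span_singleton (norm_ne_zero_iff.1 (by rw [hξ1]; simp))
  have hfV : Module.finrank ℝ V = n - 1 := by
    have := Fact.mk (show Module.finrank ℝ (EuclideanSpace ℝ (Fin n)) = (n - 1) + 1 by simp; omega)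
    exact Submodule.finrank_orthogonal_span_singleton (norm_ne_zero_iff.1 (by rw [hθ]; simp))
  let ι : V →ₗᵢ[ℝ] W :=
    { toLinearMap := LinearMap.codRestrict W ((inclusion n).toLinearMap ∘ₗ V.subtype)
        fun u => (hW _).2 (by simpa [hV u] using hinclξ u)
      norm_map' := fun u => (inclusion n).norm_map u }
  have hιc : ∀ u, (ι u : EuclideanSpace ℝ (Fin (n + 1))) = inclusion n u := fun u => rfl
  -- The downward unit normal of θ^⊥ inside ξ^⊥. It descends at rate b, so height -1 is reached from
  -- a e after the distance (a + 1) / b.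
  let ω : W := ⟨inclusion n (s • θ) - b • pole n, (hW _).2 (by
    rw [inner_sub_right, hinclξ, inner_smul_right, inner_smul_right, hpoleξ,
      real_inner_self_eq_norm_sq, hθ]
    ring)⟩
  have hωc : (ω : EuclideanSpace ℝ (Fin (n + 1))) = inclusion n (s • θ) - b • pole n := rfl
  have hω' : (ω : EuclideanSpace ℝ (Fin (n + 1))) = join (s • θ) (-b) := by
    rw [hωc, join_eq]; module
  have hω : ‖ω‖ = 1 := by
    rw [← sq_eq_sq₀ (norm_nonneg _) zero_le_one, Submodule.coe_norm, hω', norm_sq_join, norm_smul,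
      hθ, mul_pow, Real.norm_eq_abs, sq_abs]
    linarith
  have hι : ∀ u, inner ℝ (ι u) ω = 0 := fun u => by
    rw [Submodule.coe_inner, hιc, hω', inclusion_apply, inner_join, inner_smul_right,
      real_inner_comm, hV]
    simp
  -- The vector from a e to the center a s ξ of the slice.
  let q : W := ⟨a • (s • ξ - pole n), (hW _).2 (by
    rw [inner_smul_right, inner_sub_right, inner_smul_right, hpoleξ,
      real_inner_self_eq_norm_sq, hξ1]
    ring)⟩
  have hqc : (q : EuclideanSpace ℝ (Fin (n + 1))) = a • (s • ξ - pole n) := rfl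
  have hqq : r ^ 2 - ‖q‖ ^ 2 = 1 - a ^ 2 := by
    rw [hr2, Submodule.coe_norm, hqc, norm_smul, mul_pow, norm_sub_sq_real, norm_smul, hξ1,
      norm_pole, real_inner_smul_left, hpoleξ, Real.norm_eq_abs, Real.norm_eq_abs, sq_abs, mul_one,
      sq_abs]
    ring
  have hh : 0 < (a + 1) / b := by positivity
  set x : V → EuclideanSpace ℝ (Fin n) := fun u =>
    ((a + 1) * s / b) • θ + (u : EuclideanSpace ℝ (Fin n)) with hx
  have hzx : ∀ u, ((ι u + ((a + 1) / b) • ω : W) : EuclideanSpace ℝ (Fin (n + 1))) =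
      inclusion n (x u) - (a + 1) • pole n := fun u => by
    rw [Submodule.coe_add, Submodule.coe_smul, hιc, hωc, hx, map_add, map_smul, map_smul, smul_sub,
      smul_smul, smul_smul, div_mul_cancel₀ _ hb0.ne', div_mul_eq_mul_div]
    abel
  have hzq : ∀ u, inner ℝ (ι u + ((a + 1) / b) • ω) q = a * (a + 1) := fun u => by
    have hz0 : inner ℝ ((ι u + ((a + 1) / b) • ω : W) : EuclideanSpace ℝ (Fin (n + 1))) ξ = 0 := by
      rw [real_inner_comm]
      exact (hW _).1 (Subtype.coe_prop _)
    rw [Submodule.coe_inner, hqc, inner_smul_right, inner_sub_right, inner_smul_right, hz0, hzx,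
      inner_sub_left, inner_inclusion_pole, real_inner_smul_left, real_inner_self_eq_norm_sq,
      norm_pole]
    ring
  have hzn : ∀ u, ‖ι u + ((a + 1) / b) • ω‖ ^ 2 = ‖x u‖ ^ 2 + (a + 1) ^ 2 := fun u => by
    rw [Submodule.coe_norm, hzx, sub_eq_add_neg, ← neg_smul,
      norm_sq_add_smul _ norm_pole inner_inclusion_pole, neg_sq]
  have key := lintegral_toSphere_shift ι hω hι (by rw [hfW, hfV]; omega)
    (norm_inv_smul_lt_one ha ha' hr0 hqq) hh
    (F := fun w : W => F (a • pole n + r • (w : EuclideanSpace ℝ (Fin (n + 1)))))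
    (by fun_prop) hfV
  have hms : MeasurableSet (slice a ξ) := measurableSet_slice ξ
  rw [← lintegral_indicator hms, sliceMeasure, lintegral_roundSphereMeasure _ _ _
    (hF.indicator hms), hheight, ← hr]
  change ENNReal.ofReal (r ^ (Module.finrank ℝ W - 1)) * _ = _
  have hcenter : ∀ u : W, (s * a) • ξ + r • (u : EuclideanSpace ℝ (Fin (n + 1))) =
      a • pole n + r • ((u + r⁻¹ • q : W) : EuclideanSpace ℝ (Fin (n + 1))) := fun u => by
    rw [Submodule.coe_add, Submodule.coe_smul, hqc, smul_add, smul_smul r, mul_inv_cancel₀ hr0.ne']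
    module
  -- Within ξ^⊥ the sign of the ω-component is opposite to that of the height, so the half space is
  -- the condition η_{n+1} < a.
  have hωin : ∀ w : W, inner ℝ w ω * b = -height (w : EuclideanSpace ℝ (Fin (n + 1))) := fun w => by
    have h0 := (hW _).1 w.2
    rw [← join_horiz_height (w : EuclideanSpace ℝ (Fin (n + 1))), hξ, inner_join,
      real_inner_smul_left, real_inner_comm] at h0
    rw [Submodule.coe_inner, ← join_horiz_height (w : EuclideanSpace ℝ (Fin (n + 1))), hω',
      inner_join, inner_smul_right, height_join]
    linear_combination s * h0 - height (w : EuclideanSpace ℝ (Fin (n + 1))) * hb2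
  have hmem : ∀ u : sphere (0 : W) 1,
      a • pole n + r • (((u : W) + r⁻¹ • q : W) : EuclideanSpace ℝ (Fin (n + 1))) ∈ slice a ξ ↔
        (u : W) + r⁻¹ • q ∈ {w | 0 < inner ℝ w ω} := fun u => by
    have hu : ‖((u : W) : EuclideanSpace ℝ (Fin (n + 1)))‖ = 1 := by
      rw [← Submodule.coe_norm]; simp
    have hξu : inner ℝ ξ ((u : W) : EuclideanSpace ℝ (Fin (n + 1))) = 0 := (hW _).1 (u : W).2
    have hsph : ‖(s * a) • ξ + r • ((u : W) : EuclideanSpace ℝ (Fin (n + 1)))‖ = 1 := by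
      rw [← sq_eq_sq₀ (norm_nonneg _) zero_le_one, norm_add_sq_real, real_inner_smul_left,
        inner_smul_right, hξu, norm_smul, norm_smul, hu, hξ1, mul_one, mul_one, Real.norm_eq_abs,
        Real.norm_eq_abs, sq_abs, sq_abs, hr2]
      ring
    have hin : inner ℝ ξ ((s * a) • ξ + r • ((u : W) : EuclideanSpace ℝ (Fin (n + 1)))) =
        a * height ξ := by
      rw [inner_add_right, inner_smul_right, inner_smul_right, hξu, real_inner_self_eq_norm_sq,
        hξ1, hheight]
      ring
    rw [hcenter] at hsph hin
    have hht :
        height (a • pole n + r • (((u : W) + r⁻¹ • q : W) : EuclideanSpace ℝ (Fin (n + 1)))) =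
        a + r * height (((u : W) + r⁻¹ • q : W) : EuclideanSpace ℝ (Fin (n + 1))) := by
      rw [← inner_pole, inner_add_left, real_inner_smul_left, real_inner_smul_left, inner_pole,
        inner_pole, pole, height_join, mul_one]
    have hsign : (a + r * height (((u : W) + r⁻¹ • q : W) : EuclideanSpace ℝ (Fin (n + 1))) < a) ↔
        0 < inner ℝ ((u : W) + r⁻¹ • q) ω := by
      rw [← mul_pos_iff_of_pos_right hb0, hωin, Left.neg_pos_iff, add_lt_iff_neg_left]
      exact ⟨fun h => neg_of_mul_neg_right h hr0.le, mul_neg_of_pos_of_neg hr0⟩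
    rw [mem_ofPred_eq, ← hsign, ← hht]
    constructor
    · rintro ⟨⟨-, h⟩, -⟩
      exact h
    · intro h
      exact ⟨⟨by rw [unitSphere, mem_sphere_zero_iff_norm, hsph], h⟩, hin⟩
  have hl : ∀ u : sphere (0 : W) 1,
      (slice a ξ).indicator F ((a * s) • ξ + r • ((u : W) : EuclideanSpace ℝ (Fin (n + 1)))) =
      {w | 0 < inner ℝ w ω}.indicator
        (fun w : W => F (a • pole n + r • (w : EuclideanSpace ℝ (Fin (n + 1)))))
          ((u : W) + r⁻¹ • q) := fun u => by
    rw [mul_comm, hcenter]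
    by_cases hu : (u : W) + r⁻¹ • q ∈ {w | 0 < inner ℝ w ω}
    · rw [indicator_of_mem hu, indicator_of_mem ((hmem u).2 hu)]
    · rw [indicator_of_notMem hu, indicator_of_notMem (mt (hmem u).1 hu)]
  rw [hfW]
  refine (congrArg (ENNReal.ofReal (r ^ (n - 1)) * ·)
    ((lintegral_congr hl).trans key)).trans ?_
  rw [← lintegral_const_mul']
  · refine lintegral_congr fun u => ?_
    have hP := P_pos ha ha' (x u)
    have hD := D_pos ha ha' (x u)
    rw [gaugeRoot_inv_smul ha ha' hr0 hqq (hzq u) (hzn u),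
      gauge_inv_smul ha ha' hr0 hqq (hzq u) (hzn u), ← mul_assoc,
      ← ENNReal.ofReal_mul (by positivity)]
    congr 2
    -- The powers of r combine to a single r, and r / b is the factor of 𝒱_a.
    · change _ = _ * ((a + 1) * P a (x u) ^ (n - 1) / D a (x u))
      rw [Real.sqrt_div (by linarith), ← hr, ← hb, div_pow]
      field_simp
    · rw [proj_eq ha, Submodule.coe_smul, hzx, inv_div, smul_smul, mul_div_cancel₀ _ hr0.ne']
  · exact ENNReal.ofReal_ne_top

theorem continuous_proj_hyperplane (ha : -1 < a) (θ : EuclideanSpace ℝ (Fin n)) (t : ℝ) :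
    Continuous fun u : (Submodule.span ℝ {θ})ᗮ =>
      proj a (t • θ + (u : EuclideanSpace ℝ (Fin n))) :=
  (continuous_proj ha).comp (by fun_prop)

/-- The surface measure of a truncated slice as the image of a measure on a hyperplane. -/
theorem restrict_sliceMeasure (hn : 2 ≤ n) (ha : -1 < a) (ha' : a < 1) (hs : s ^ 2 < 1)
    {θ : EuclideanSpace ℝ (Fin n)} (hθ : ‖θ‖ = 1) :
    (sliceMeasure a (join (Real.sqrt (1 - s ^ 2) • θ) s)).restrict
        (slice a (join (Real.sqrt (1 - s ^ 2) • θ) s)) =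
      ((perpMeasure θ).withDensity fun u =>
        (Real.sqrt ((1 - a ^ 2 * s ^ 2) / (1 - s ^ 2)) * ((a + 1) *
          P a (((a + 1) * s / Real.sqrt (1 - s ^ 2)) • θ + (u : EuclideanSpace ℝ (Fin n))) ^ (n - 1)
          / D a (((a + 1) * s / Real.sqrt (1 - s ^ 2)) • θ +
            (u : EuclideanSpace ℝ (Fin n))))).toNNReal).map
        fun u : (Submodule.span ℝ {θ})ᗮ => proj a (((a + 1) * s / Real.sqrt (1 - s ^ 2)) • θ +
          (u : EuclideanSpace ℝ (Fin n))) := by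
  refine Measure.ext fun A hA => ?_
  have h := setLIntegral_slice hn ha ha' hs hθ (measurable_one.indicator hA)
  have hm := (continuous_proj_hyperplane ha θ ((a + 1) * s / Real.sqrt (1 - s ^ 2))).measurable
  rw [lintegral_indicator_one hA] at h
  refine h.trans ?_
  rw [Measure.map_apply hm hA, withDensity_apply _ (hm hA), ← lintegral_indicator (hm hA)]
  refine lintegral_congr fun u => ?_
  by_cases hu : proj a (((a + 1) * s / Real.sqrt (1 - s ^ 2)) • θ +
      (u : EuclideanSpace ℝ (Fin n))) ∈ A
  · rw [indicator_of_mem hu, indicator_of_mem (by exact hu), Pi.one_apply, mul_one]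
    rfl
  · rw [indicator_of_notMem hu, indicator_of_notMem (by exact hu), mul_zero]

theorem dir_offset_of_mem {ξ : EuclideanSpace ℝ (Fin (n + 1))} (hξ : ξ ∈ unitSphere n)
    (h0 : horiz ξ ≠ 0) :
    height ξ ^ 2 < 1 ∧ ‖dir ξ‖ = 1 ∧
      ξ = join (Real.sqrt (1 - height ξ ^ 2) • dir ξ) (height ξ) := by
  have h1 : ‖horiz ξ‖ ^ 2 + height ξ ^ 2 = 1 := by
    rw [← norm_sq_join, join_horiz_height, mem_sphere_zero_iff_norm.1 hξ, one_pow]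
  have h2 : 0 < ‖horiz ξ‖ := norm_pos_iff.2 h0
  have h3 : Real.sqrt (1 - height ξ ^ 2) = ‖horiz ξ‖ := by
    rw [← h1, add_sub_cancel_right, Real.sqrt_sq h2.le]
  refine ⟨by nlinarith, ?_, ?_⟩
  · rw [dir, norm_smul, norm_inv, norm_norm, inv_mul_cancel₀ h2.ne']
  · rw [h3, dir, smul_smul, mul_inv_cancel₀ h2.ne', one_smul, join_horiz_height]

variable {𝕜 : Type*} [RCLike 𝕜]

/-- The weight of `restrict_sliceMeasure`, multiplied by `f ∘ π`, is a multiple of `𝒰_a f`. -/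
theorem weight_smul_eq_opU (ha : -1 < a) (ha' : a < 1) {c : ℝ} (hc : 0 ≤ c)
    (f : EuclideanSpace ℝ (Fin (n + 1)) → 𝕜) (x : EuclideanSpace ℝ (Fin n)) :
    (c * ((a + 1) * P a x ^ (n - 1) / D a x)).toNNReal • f (proj a x) = c • opU a f x := by
  have hP := P_pos ha ha' x
  have hD := D_pos ha ha' x
  have h1 : 0 < a + 1 := by linarith
  rw [NNReal.smul_def, Real.coe_toNNReal _ (by positivity), opU, smul_smul]

theorem measurable_weight (ha : -1 < a) (c t : ℝ) (θ : EuclideanSpace ℝ (Fin n)) :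
    Measurable fun u : (Submodule.span ℝ {θ})ᗮ =>
      (c * ((a + 1) * P a (t • θ + (u : EuclideanSpace ℝ (Fin n))) ^ (n - 1) /
        D a (t • θ + (u : EuclideanSpace ℝ (Fin n))))).toNNReal := by
  have h1 := (continuous_P (n := n) ha).measurable
  have h2 := (continuous_D (n := n) (a := a)).measurable
  have h3 : Measurable fun x : EuclideanSpace ℝ (Fin n) =>
      (c * ((a + 1) * P a x ^ (n - 1) / D a x)).toNNReal := by fun_prop
  exact h3.comp (by fun_prop)

/-- Being a measurable embedding lets integrals be transported for arbitrary f. This matters since a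
slice is a null set of Sⁿ, where f need not be measurable. -/
theorem measurableEmbedding_proj_hyperplane (ha : -1 < a) (ha' : a < 1)
    (θ : EuclideanSpace ℝ (Fin n)) (t : ℝ) :
    MeasurableEmbedding fun u : (Submodule.span ℝ {θ})ᗮ =>
      proj a (t • θ + (u : EuclideanSpace ℝ (Fin n))) :=
  (continuous_proj_hyperplane ha θ t).measurableEmbedding fun _ _ h =>
    Subtype.ext (add_left_cancel (proj_injective ha ha' h))

/-- Away from the poles, the slice integral of any function converges absolutely if and only if
the corresponding integral over a hyperplane does, and both are proportional. -/
theorem slice_integral_identity (hn : 2 ≤ n) (ha : -1 < a) (ha' : a < 1)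
    (f : EuclideanSpace ℝ (Fin (n + 1)) → 𝕜) {ξ : EuclideanSpace ℝ (Fin (n + 1))}
    (hξ : ξ ∈ unitSphere n) (h0 : horiz ξ ≠ 0) :
    (IntegrableOn f (slice a ξ) (sliceMeasure a ξ) ↔
      Integrable (fun u : (Submodule.span ℝ {dir ξ})ᗮ =>
        opU a f (offset a ξ • dir ξ + (u : EuclideanSpace ℝ (Fin n)))) (perpMeasure (dir ξ))) ∧
    sliceTransform a f ξ = opV a (radon (opU a f)) ξ := by
  obtain ⟨hs, hθ, hj⟩ := dir_offset_of_mem hξ h0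
  have hr := restrict_sliceMeasure hn ha ha' hs hθ
  have ho : (a + 1) * height ξ / Real.sqrt (1 - height ξ ^ 2) = offset a ξ := rfl
  rw [← hj, ho] at hr
  have hemb := measurableEmbedding_proj_hyperplane ha ha' (dir ξ) (offset a ξ)
  have hwm := measurable_weight ha
    (Real.sqrt ((1 - a ^ 2 * height ξ ^ 2) / (1 - height ξ ^ 2))) (offset a ξ) (dir ξ)
  have hc : 0 < Real.sqrt ((1 - a ^ 2 * height ξ ^ 2) / (1 - height ξ ^ 2)) := by
    refine Real.sqrt_pos.2 (div_pos ?_ ?_) <;> nlinarith [sq_nonneg a, sq_nonneg (height ξ)]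
  constructor
  · rw [IntegrableOn, hr]
    refine (hemb.integrable_map_iff).trans ?_
    rw [integrable_withDensity_iff_integrable_smul hwm]
    simp only [Function.comp_apply]
    simp_rw [weight_smul_eq_opU ha ha' hc.le]
    exact integrable_fun_smul_iff hc.ne' _
  · rw [sliceTransform, hr]
    refine (hemb.integral_map f).trans ?_
    rw [integral_withDensity_eq_integral_smul hwm, opV, radon, ← integral_smul]
    exact integral_congr_ae (.of_forall fun u => weight_smul_eq_opU ha ha' hc.le f _)

end Slice

/-! ### Averages of hyperplane integrals over directions and offsets. -/

section Hyperplanes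

variable {n : ℕ}

theorem finrank_span_orthogonal {θ : EuclideanSpace ℝ (Fin n)} (hθ : ‖θ‖ = 1) :
    Module.finrank ℝ (EuclideanSpace ℝ (Fin n)) =
      Module.finrank ℝ (Submodule.span ℝ {θ})ᗮ + 1 := by
  rw [← Submodule.finrank_add_finrank_orthogonal (Submodule.span ℝ {θ}),
    finrank_span_singleton (norm_ne_zero_iff.1 (by rw [hθ]; simp)), add_comm]

theorem inner_orthogonal_span {θ : EuclideanSpace ℝ (Fin n)} (u : (Submodule.span ℝ {θ})ᗮ) :
    inner ℝ ((Submodule.span ℝ {θ})ᗮ.subtypeₗᵢ u) θ = 0 := by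
  rw [real_inner_comm]
  exact Submodule.mem_orthogonal_singleton_iff_inner_right.1 u.2

theorem measurePreserving_perp {θ : EuclideanSpace ℝ (Fin n)} (hθ : ‖θ‖ = 1) :
    MeasurePreserving (fun p : (Submodule.span ℝ {θ})ᗮ × ℝ =>
      (p.1 : EuclideanSpace ℝ (Fin n)) + p.2 • θ) ((perpMeasure θ).prod volume) volume :=
  measurePreserving_add_smul (Submodule.span ℝ {θ})ᗮ.subtypeₗᵢ hθ inner_orthogonal_span
    (finrank_span_orthogonal hθ)

theorem lintegral_perp {θ : EuclideanSpace ℝ (Fin n)} (hθ : ‖θ‖ = 1)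
    {g : EuclideanSpace ℝ (Fin n) → ℝ≥0∞} (hg : Measurable g) :
    ∫⁻ x, g x = ∫⁻ t : ℝ, (∫⁻ u, g ((u : EuclideanSpace ℝ (Fin n)) + t • θ) ∂(perpMeasure θ)) :=
  lintegral_eq_lintegral_add_smul (Submodule.span ℝ {θ})ᗮ.subtypeₗᵢ hθ inner_orthogonal_span
    (finrank_span_orthogonal hθ) hg

theorem inner_perp_add_smul {θ : EuclideanSpace ℝ (Fin n)} (hθ : ‖θ‖ = 1)
    (u : (Submodule.span ℝ {θ})ᗮ) (t : ℝ) :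
    inner ℝ ((u : EuclideanSpace ℝ (Fin n)) + t • θ) θ = t := by
  have : inner ℝ (u : EuclideanSpace ℝ (Fin n)) θ = 0 := inner_orthogonal_span u
  rw [inner_add_left, this, real_inner_smul_left, real_inner_self_eq_norm_sq, hθ]
  simp

/-- The integral of `g` over the hyperplane `{x · θ = t}`, written as an integral over a layer
of thickness one; this form is jointly measurable in `θ` and `t`. -/
def layerIntegral (g : EuclideanSpace ℝ (Fin n) → ℝ≥0∞) (θ : EuclideanSpace ℝ (Fin n)) (t : ℝ) :
    ℝ≥0∞ :=
  ∫⁻ y, (Icc (0 : ℝ) 1).indicator 1 (inner ℝ y θ) * g (y + (t - inner ℝ y θ) • θ)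

theorem measurable_layerIntegral {g : EuclideanSpace ℝ (Fin n) → ℝ≥0∞} (hg : Measurable g) :
    Measurable fun p : EuclideanSpace ℝ (Fin n) × ℝ => layerIntegral g p.1 p.2 := by
  refine Measurable.lintegral_prod_right' (f := fun q : (EuclideanSpace ℝ (Fin n) × ℝ) ×
    EuclideanSpace ℝ (Fin n) => (Icc (0 : ℝ) 1).indicator 1 (inner ℝ q.2 q.1.1) *
      g (q.2 + (q.1.2 - inner ℝ q.2 q.1.1) • q.1.1)) ?_
  refine Measurable.mul ?_ (hg.comp (by fun_prop))
  exact (measurable_one.indicator measurableSet_Icc).comp (by fun_prop)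

theorem measurable_layerIntegral_right {g : EuclideanSpace ℝ (Fin n) → ℝ≥0∞} (hg : Measurable g)
    (θ : EuclideanSpace ℝ (Fin n)) : Measurable (layerIntegral g θ) :=
  Measurable.comp (g := fun p : EuclideanSpace ℝ (Fin n) × ℝ => layerIntegral g p.1 p.2)
    (f := fun t : ℝ => (θ, t)) (measurable_layerIntegral hg) measurable_prodMk_left

/-- Moving y along θ to the hyperplane {x · θ = t} makes every layer of the slab contribute the same
integral, and the slab has thickness one. -/
theorem layerIntegral_eq {θ : EuclideanSpace ℝ (Fin n)} (hθ : ‖θ‖ = 1) (t : ℝ)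
    {g : EuclideanSpace ℝ (Fin n) → ℝ≥0∞} (hg : Measurable g) :
    layerIntegral g θ t = ∫⁻ u, g (t • θ + (u : EuclideanSpace ℝ (Fin n))) ∂(perpMeasure θ) := by
  rw [layerIntegral, lintegral_perp hθ]
  · have key : ∀ τ : ℝ, ∀ u : (Submodule.span ℝ {θ})ᗮ,
        (u : EuclideanSpace ℝ (Fin n)) + τ • θ + (t - τ) • θ = t • θ + u := fun τ u => by module
    simp_rw [inner_perp_add_smul hθ, key]
    have hgm : Measurable fun u : (Submodule.span ℝ {θ})ᗮ =>
      g (t • θ + (u : EuclideanSpace ℝ (Fin n))) := hg.comp (by fun_prop)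
    simp_rw [lintegral_const_mul _ hgm]
    rw [lintegral_mul_const _ (measurable_one.indicator measurableSet_Icc),
      lintegral_indicator_one measurableSet_Icc]
    simp
  · exact Measurable.mul ((measurable_one.indicator measurableSet_Icc).comp (by fun_prop))
      (hg.comp (by fun_prop))

theorem lintegral_mul_layerIntegral {θ : EuclideanSpace ℝ (Fin n)} (hθ : ‖θ‖ = 1)
    {g : EuclideanSpace ℝ (Fin n) → ℝ≥0∞} (hg : Measurable g) {w : ℝ → ℝ≥0∞} (hw : Measurable w) :
    ∫⁻ t, w t * layerIntegral g θ t = ∫⁻ x, w (inner ℝ x θ) * g x := by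
  have hm : Measurable fun x : EuclideanSpace ℝ (Fin n) => w (inner ℝ x θ) * g x := by fun_prop
  rw [lintegral_perp hθ hm]
  refine lintegral_congr fun t => ?_
  have hgm : Measurable fun u : (Submodule.span ℝ {θ})ᗮ =>
    g (t • θ + (u : EuclideanSpace ℝ (Fin n))) := hg.comp (by fun_prop)
  rw [layerIntegral_eq hθ t hg, ← lintegral_const_mul _ hgm]
  refine lintegral_congr fun u => ?_
  rw [inner_perp_add_smul hθ, add_comm]

/-- The part of the unit ball in a layer orthogonal to `x`. -/
theorem norm_mul_volume_layer_le (x : EuclideanSpace ℝ (Fin n)) {T : ℝ} (hT : 0 ≤ T) :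
    ENNReal.ofReal ‖x‖ * volume {v : EuclideanSpace ℝ (Fin n) | ‖v‖ ≤ 1 ∧ |inner ℝ x v| ≤ T} ≤
      ENNReal.ofReal T * volume (closedBall (0 : EuclideanSpace ℝ (Fin n)) 2) := by
  by_cases hx : x = 0
  · simp [hx]
  have hx' : 0 < ‖x‖ := norm_pos_iff.2 hx
  set θ := ‖x‖⁻¹ • x with hθd
  have hθ : ‖θ‖ = 1 := by rw [hθd, norm_smul, norm_inv, norm_norm, inv_mul_cancel₀ hx'.ne']
  have hxθ : x = ‖x‖ • θ := by rw [hθd, smul_smul, mul_inv_cancel₀ hx'.ne', one_smul]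
  have hmp := measurePreserving_perp hθ
  have hnorm : ∀ p : (Submodule.span ℝ {θ})ᗮ × ℝ,
      ‖(p.1 : EuclideanSpace ℝ (Fin n)) + p.2 • θ‖ ^ 2 = ‖p.1‖ ^ 2 + p.2 ^ 2 := fun p =>
    norm_sq_add_smul (Submodule.span ℝ {θ})ᗮ.subtypeₗᵢ hθ inner_orthogonal_span p.1 p.2
  have hA : MeasurableSet {v : EuclideanSpace ℝ (Fin n) | ‖v‖ ≤ 1 ∧ |inner ℝ x v| ≤ T} :=
    MeasurableSet.inter (s₁ := {v : EuclideanSpace ℝ (Fin n) | ‖v‖ ≤ 1})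
      (s₂ := {v | |inner ℝ x v| ≤ T}) (measurableSet_le (by fun_prop) measurable_const)
      (measurableSet_le (by fun_prop) measurable_const)
  have h1 : volume {v : EuclideanSpace ℝ (Fin n) | ‖v‖ ≤ 1 ∧ |inner ℝ x v| ≤ T} ≤
      perpMeasure θ (closedBall 0 1) * ENNReal.ofReal (2 * (T / ‖x‖)) := by
    rw [← hmp.measure_preimage hA.nullMeasurableSet]
    refine (measure_mono (t := closedBall 0 1 ×ˢ Icc (-(T / ‖x‖)) (T / ‖x‖)) ?_).trans
      (le_of_eq ?_)
    · rintro ⟨u, t⟩ ⟨h1, h2⟩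
      have hn := hnorm (u, t)
      constructor
      · rw [mem_closedBall_zero_iff]
        refine le_of_sq_le_sq ?_ zero_le_one
        simp only at h1 hn
        nlinarith [sq_nonneg t, norm_nonneg ((u : EuclideanSpace ℝ (Fin n)) + t • θ)]
      · simp only at h2
        rw [hxθ, real_inner_smul_left, real_inner_comm, inner_perp_add_smul hθ, abs_mul,
          abs_norm] at h2
        rw [mem_Icc, ← abs_le, le_div_iff₀ hx', mul_comm]
        exact h2
    · rw [Measure.prod_prod, Real.volume_Icc]
      congr 2
      ring
  -- Bounds the unit ball of θ^⊥ uniformly in θ: its product with [-1, 1] lies in the ball of radius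
  -- 2.
  have h2 : perpMeasure θ (closedBall 0 1) * ENNReal.ofReal 2 ≤
      volume (closedBall (0 : EuclideanSpace ℝ (Fin n)) 2) := by
    rw [← hmp.measure_preimage measurableSet_closedBall.nullMeasurableSet]
    refine le_trans (le_of_eq ?_) (measure_mono (s := closedBall 0 1 ×ˢ Icc (-1) 1) ?_)
    · rw [Measure.prod_prod, Real.volume_Icc]
      norm_num
    · rintro ⟨u, t⟩ ⟨h1, h2⟩
      have hn := hnorm (u, t)
      rw [mem_closedBall_zero_iff] at h1
      rw [mem_preimage, mem_closedBall_zero_iff]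
      refine le_of_sq_le_sq ?_ zero_le_two
      rw [hn]
      have h3 : t ^ 2 ≤ 1 := (sq_le_one_iff_abs_le_one t).2 (abs_le.2 h2)
      simp only at h1 ⊢
      nlinarith [norm_nonneg u]
  calc ENNReal.ofReal ‖x‖ * volume {v : EuclideanSpace ℝ (Fin n) | ‖v‖ ≤ 1 ∧ |inner ℝ x v| ≤ T}
      ≤ ENNReal.ofReal ‖x‖ *
        (perpMeasure θ (closedBall 0 1) * ENNReal.ofReal (2 * (T / ‖x‖))) := by gcongr
    _ = ENNReal.ofReal T * (perpMeasure θ (closedBall 0 1) * ENNReal.ofReal 2) := by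
        rw [mul_left_comm, ← ENNReal.ofReal_mul hx'.le, mul_left_comm (ENNReal.ofReal T),
          ← ENNReal.ofReal_mul hT]
        congr 2
        field_simp
    _ ≤ _ := by gcongr

theorem lintegral_eq_lintegral_comp_mul_left {c : ℝ} (hc : 0 < c) {f : ℝ → ℝ≥0∞}
    (hf : Measurable f) : ∫⁻ t, f t = ENNReal.ofReal c * ∫⁻ t, f (c * t) := by
  rw [← lintegral_map hf (measurable_const_mul c), Real.map_volume_mul_left hc.ne',
    lintegral_smul_measure, smul_eq_mul, ← mul_assoc, ← ENNReal.ofReal_mul hc.le,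
    abs_of_pos (inv_pos.2 hc), mul_inv_cancel₀ hc.ne']
  simp

/-- Substitute t = bσ / ‖v‖; then dσ = (‖v‖ / b) dt, with ‖v‖ ≤ 1, and |t| ≤ b / ‖v‖ with t = x · v
/ ‖v‖ means |x · v| ≤ b. -/
theorem lintegral_layerIntegral_le {b : ℝ} (hb : 0 < b) {v : EuclideanSpace ℝ (Fin n)}
    (hv : v ≠ 0) (hv1 : ‖v‖ ≤ 1) {g : EuclideanSpace ℝ (Fin n) → ℝ≥0∞} (hg : Measurable g) :
    ∫⁻ σ in Icc (-1 : ℝ) 1, layerIntegral g (‖v‖⁻¹ • v) (b * σ / ‖v‖) ≤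
      ENNReal.ofReal b⁻¹ * ∫⁻ x, {x | |inner ℝ x v| ≤ b}.indicator g x := by
  have hv0 : 0 < ‖v‖ := norm_pos_iff.2 hv
  have hθ : ‖‖v‖⁻¹ • v‖ = 1 := by rw [norm_smul, norm_inv, norm_norm, inv_mul_cancel₀ hv0.ne']
  have hF := measurable_layerIntegral_right hg (‖v‖⁻¹ • v)
  have hI : Measurable ((Icc (-1 : ℝ) 1).indicator (1 : ℝ → ℝ≥0∞)) :=
    measurable_one.indicator measurableSet_Icc
  have hgm : Measurable fun σ : ℝ => (Icc (-1 : ℝ) 1).indicator (1 : ℝ → ℝ≥0∞) σ *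
      layerIntegral g (‖v‖⁻¹ • v) (b * σ / ‖v‖) := hI.mul (hF.comp (by fun_prop))
  rw [← lintegral_indicator measurableSet_Icc]
  have e1 : ∀ σ : ℝ, (Icc (-1 : ℝ) 1).indicator
      (fun σ => layerIntegral g (‖v‖⁻¹ • v) (b * σ / ‖v‖)) σ =
      (Icc (-1 : ℝ) 1).indicator (1 : ℝ → ℝ≥0∞) σ *
        layerIntegral g (‖v‖⁻¹ • v) (b * σ / ‖v‖) := fun σ => by
    by_cases hσ : σ ∈ Icc (-1 : ℝ) 1
    · rw [indicator_of_mem hσ, indicator_of_mem hσ, Pi.one_apply, one_mul]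
    · rw [indicator_of_notMem hσ, indicator_of_notMem hσ, zero_mul]
  rw [lintegral_congr e1, lintegral_eq_lintegral_comp_mul_left (c := ‖v‖ / b) (by positivity) hgm]
  have e2 : ∀ t : ℝ, b * (‖v‖ / b * t) / ‖v‖ = t := fun t => by
    field_simp
  simp_rw [e2]
  have h2 := lintegral_mul_layerIntegral hθ hg
    (w := fun t => (Icc (-1 : ℝ) 1).indicator (1 : ℝ → ℝ≥0∞) (‖v‖ / b * t))
    (hI.comp (by fun_prop))
  rw [h2]
  refine mul_le_mul' (ENNReal.ofReal_le_ofReal ?_) (lintegral_mono fun x => ?_)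
  · rw [div_eq_mul_inv]
    exact mul_le_of_le_one_left (by positivity) hv1
  · have e3 : ‖v‖ / b * inner ℝ x (‖v‖⁻¹ • v) = inner ℝ x v / b := by
      rw [inner_smul_right]; field_simp
    rw [e3]
    by_cases hx : |inner ℝ x v| ≤ b
    · rw [indicator_of_mem (s := {x | |inner ℝ x v| ≤ b}) hx]
      refine mul_le_of_le_one_left zero_le ?_
      exact indicator_le_self' (by simp) _
    · rw [indicator_of_notMem (s := {x | |inner ℝ x v| ≤ b}) hx, indicator_of_notMem, zero_mul]
      rw [mem_Icc, ← abs_le, abs_div, abs_of_pos hb, div_le_one hb]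
      exact hx

theorem lintegral_lintegral_layerIntegral_le [NeZero n] {b : ℝ} (hb : 0 < b)
    {g : EuclideanSpace ℝ (Fin n) → ℝ≥0∞} (hg : Measurable g) :
    ∫⁻ v in closedBall (0 : EuclideanSpace ℝ (Fin n)) 1,
      (∫⁻ σ in Icc (-1 : ℝ) 1, layerIntegral g (‖v‖⁻¹ • v) (b * σ / ‖v‖)) ≤
      ENNReal.ofReal b⁻¹ * ∫⁻ x, g x *
        volume {v : EuclideanSpace ℝ (Fin n) | ‖v‖ ≤ 1 ∧ |inner ℝ x v| ≤ b} := by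
  have hS : MeasurableSet {p : EuclideanSpace ℝ (Fin n) × EuclideanSpace ℝ (Fin n) |
      |inner ℝ p.2 p.1| ≤ b} := measurableSet_le (by fun_prop) measurable_const
  calc _ ≤ ∫⁻ v in closedBall (0 : EuclideanSpace ℝ (Fin n)) 1,
        ENNReal.ofReal b⁻¹ * ∫⁻ x, {x | |inner ℝ x v| ≤ b}.indicator g x := by
        have h0 : ∀ᵐ v : EuclideanSpace ℝ (Fin n), v ≠ 0 := by
          simp [ae_iff, measure_singleton]
        refine lintegral_mono_ae ?_
        filter_upwards [ae_restrict_of_ae h0, ae_restrict_mem measurableSet_closedBall]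
          with v hv hv1
        exact lintegral_layerIntegral_le hb hv (mem_closedBall_zero_iff.1 hv1) hg
    _ = ENNReal.ofReal b⁻¹ * ∫⁻ v in closedBall (0 : EuclideanSpace ℝ (Fin n)) 1,
          (∫⁻ x, {x | |inner ℝ x v| ≤ b}.indicator g x) :=
        lintegral_const_mul' _ _ ENNReal.ofReal_ne_top
    _ = _ := by
        congr 1
        rw [lintegral_lintegral_swap]
        · refine lintegral_congr fun x => ?_
          have hA : MeasurableSet {v : EuclideanSpace ℝ (Fin n) | |inner ℝ x v| ≤ b} :=
            measurableSet_le (by fun_prop) measurable_const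
          have e : ∀ v, {x | |inner ℝ x v| ≤ b}.indicator g x =
              {v : EuclideanSpace ℝ (Fin n) | |inner ℝ x v| ≤ b}.indicator (fun _ => g x) v :=
            fun v => by simp [indicator_apply]
          simp_rw [e]
          rw [lintegral_indicator_const hA, Measure.restrict_apply hA]
          congr 2
          ext v
          simp [and_comm]
        · exact ((hg.comp measurable_snd).indicator hS).aemeasurable

end Hyperplanes

/-! ### Absolute convergence for almost every ξ. -/

section AlmostEverywhere

variable {n : ℕ} {a : ℝ}

/-- A scaling-invariant property which holds almost everywhere near the origin of `ℝⁿ⁺¹` holds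
almost everywhere on the sphere. -/
theorem ae_sphereMeasure_of_ae {p : EuclideanSpace ℝ (Fin (n + 1)) → Prop}
    (hp : MeasurableSet {ζ | p ζ}) (hsmul : ∀ c : ℝ, 0 < c → ∀ ζ, p (c • ζ) → p ζ)
    (h : ∀ᵐ q ∂((volume : Measure (EuclideanSpace ℝ (Fin n) × ℝ)).restrict
      (closedBall 0 1 ×ˢ Icc (-1) 1)), p (join q.1 q.2)) :
    ∀ᵐ ξ ∂(sphereMeasure n), p ξ := by
  have hm : MeasurableSet {u : sphere (0 : EuclideanSpace ℝ (Fin (n + 1))) 1 | ¬ p u} :=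
    measurable_subtype_coe hp.compl
  have hS : MeasurableSet (closedBall (0 : EuclideanSpace ℝ (Fin n)) 1 ×ˢ Icc (-1 : ℝ) 1) :=
    measurableSet_closedBall.prod measurableSet_Icc
  rw [sphereMeasure, ae_map_iff measurable_subtype_coe.aemeasurable hp, ae_iff,
    Measure.toSphere_apply' _ hm]
  -- `toSphere` measures a set by the volume of the cone over it in the unit ball, and that ball
  -- lies in the cylinder of the hypothesis.
  suffices h0 : volume ({ζ | ¬ p ζ} ∩ closedBall (0 : EuclideanSpace ℝ (Fin (n + 1))) 1) = 0 by
    refine mul_eq_zero.2 (.inr (measure_mono_null ?_ h0))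
    rintro _ ⟨c, hc, _, ⟨u, hu, rfl⟩, rfl⟩
    refine ⟨fun h => hu (hsmul c hc.1 _ h), ?_⟩
    rw [mem_closedBall_zero_iff]
    simp [norm_smul, abs_of_pos hc.1, hc.2.le]
  have hB : MeasurableSet
      ({ζ | ¬ p ζ} ∩ closedBall (0 : EuclideanSpace ℝ (Fin (n + 1))) 1) :=
    hp.compl.inter measurableSet_closedBall
  rw [← measurePreserving_join.measure_preimage hB.nullMeasurableSet]
  rw [ae_restrict_iff' hS, ae_iff] at h
  refine measure_mono_null ?_ h
  rintro ⟨v, σ⟩ ⟨h1, h2⟩ h3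
  refine h1 (h3 ⟨?_, ?_⟩)
  all_goals
    have hn := norm_sq_join v σ
    have hle := mem_closedBall_zero_iff.1 h2
    simp only at hle
  · rw [mem_closedBall_zero_iff]
    refine le_of_sq_le_sq ?_ zero_le_one
    nlinarith [sq_nonneg σ, norm_nonneg (join v σ)]
  · rw [mem_Icc, ← abs_le, ← sq_le_one_iff_abs_le_one]
    nlinarith [sq_nonneg ‖v‖, norm_nonneg (join v σ)]

theorem ae_horiz_ne_zero [NeZero n] : ∀ᵐ ξ ∂(sphereMeasure n), horiz ξ ≠ 0 := by
  refine ae_sphereMeasure_of_ae (p := fun ξ => horiz ξ ≠ 0) ?_ ?_ (ae_restrict_of_ae ?_)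
  · exact (measurableSet_eq_fun continuous_horiz.measurable measurable_const).compl
  · intro c hc ζ h h0
    refine h ?_
    rw [← join_horiz_height ζ, ← join_smul, horiz_join, h0, smul_zero]
  · simp only [horiz_join]
    refine Measure.quasiMeasurePreserving_fst.ae (p := fun v => v ≠ 0) ?_
    simp [ae_iff, measure_singleton]

theorem norm_proj (ha : -1 < a) (ha' : a < 1) (x : EuclideanSpace ℝ (Fin n)) :
    ‖proj a x‖ = 1 := by
  have hD := D_pos ha ha' x
  have h1 : 0 < a + 1 := by linarith
  rw [← sq_eq_sq₀ (norm_nonneg _) zero_le_one, proj, norm_sq_join, norm_smul, mul_pow,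
    Real.norm_eq_abs, sq_abs, P, Q, div_pow, div_pow, div_mul_eq_mul_div, ← add_div,
    div_eq_iff (by positivity)]
  linear_combination (‖x‖ ^ 2 + (a + 1) ^ 2) * D_sq ha ha' x

/-- Triangle inequality for ‖π(x)‖ = 1 in the form of `proj_eq`, with a + 1 ≤ 2. Thus P decays no
faster than 1 / ‖x‖. -/
theorem one_sub_abs_le_P_mul (ha : -1 < a) (ha' : a < 1) (x : EuclideanSpace ℝ (Fin n)) :
    1 - |a| ≤ P a x * (‖x‖ + 2) := by
  have hP := P_pos ha ha' x
  have h1 : 0 < a + 1 := by linarith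
  have h := norm_proj ha ha' x
  rw [proj_eq ha] at h
  have h2 := norm_add_le (a • pole n) (P a x • (inclusion n x - (a + 1) • pole n))
  have h3 := norm_sub_le (inclusion n x) ((a + 1) • pole n)
  rw [norm_smul, norm_pole, mul_one, norm_smul, Real.norm_of_nonneg hP.le, h,
    Real.norm_eq_abs] at h2
  rw [norm_smul, norm_pole, (inclusion n).norm_map, Real.norm_of_nonneg h1.le] at h3
  nlinarith

/-- The modulus of `𝒰_a f`, for a function `f` with modulus `G`. -/
def weighted (a : ℝ) (G : EuclideanSpace ℝ (Fin (n + 1)) → ℝ≥0∞) (x : EuclideanSpace ℝ (Fin n)) :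
    ℝ≥0∞ :=
  ENNReal.ofReal ((a + 1) * P a x ^ (n - 1) / D a x) * G (proj a x)

theorem measurable_weighted (ha : -1 < a) {G : EuclideanSpace ℝ (Fin (n + 1)) → ℝ≥0∞}
    (hG : Measurable G) : Measurable (weighted a G) := by
  have h1 := (continuous_P (n := n) ha).measurable
  have h2 := (continuous_D (n := n) (a := a)).measurable
  have h3 := (continuous_proj (n := n) ha).measurable
  unfold weighted
  fun_prop

/-- The layer has volume of order at most 1 / (‖x‖ + 2): `norm_mul_volume_layer_le` handles large x,
the trivial bound handles small x. -/
theorem volume_layer_le (ha : -1 < a) (ha' : a < 1) (x : EuclideanSpace ℝ (Fin n)) :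
    volume {v : EuclideanSpace ℝ (Fin n) | ‖v‖ ≤ 1 ∧ |inner ℝ x v| ≤ a + 1} ≤
      ENNReal.ofReal (P a x) * (ENNReal.ofReal ((a + 3) / (1 - |a|)) *
        volume (closedBall (0 : EuclideanSpace ℝ (Fin n)) 2)) := by
  have h1 : 0 < a + 1 := by linarith
  have hP := P_pos ha ha' x
  have habs : 0 < 1 - |a| := sub_pos.2 (abs_lt.2 ⟨ha, ha'⟩)
  set A := {v : EuclideanSpace ℝ (Fin n) | ‖v‖ ≤ 1 ∧ |inner ℝ x v| ≤ a + 1}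
  set B := volume (closedBall (0 : EuclideanSpace ℝ (Fin n)) 2)
  have h2 : volume A ≤ B := measure_mono fun v hv => by
    rw [mem_closedBall_zero_iff]; linarith [hv.1]
  have h3 : ENNReal.ofReal (‖x‖ + 2) * volume A ≤ ENNReal.ofReal (a + 3) * B := by
    rw [ENNReal.ofReal_add (norm_nonneg _) zero_le_two, add_mul, show a + 3 = (a + 1) + 2 by ring,
      ENNReal.ofReal_add h1.le zero_le_two, add_mul]
    exact add_le_add (norm_mul_volume_layer_le x h1.le) (by gcongr)
  have h4 : 1 ≤ P a x / (1 - |a|) * (‖x‖ + 2) := by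
    rw [div_mul_eq_mul_div, one_le_div habs]
    exact one_sub_abs_le_P_mul ha ha' x
  calc volume A ≤ ENNReal.ofReal (P a x / (1 - |a|) * (‖x‖ + 2)) * volume A :=
        le_mul_of_one_le_left zero_le (by simpa using h4)
    _ = ENNReal.ofReal (P a x / (1 - |a|)) * (ENNReal.ofReal (‖x‖ + 2) * volume A) := by
        rw [ENNReal.ofReal_mul (by positivity), mul_assoc]
    _ ≤ ENNReal.ofReal (P a x / (1 - |a|)) * (ENNReal.ofReal (a + 3) * B) := by gcongr
    _ = _ := by
        rw [← mul_assoc, ← mul_assoc, ← ENNReal.ofReal_mul (by positivity),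
          ← ENNReal.ofReal_mul hP.le]
        congr 2
        ring

theorem lintegral_layerIntegral_weighted_le [NeZero n] (ha : -1 < a) (ha' : a < 1)
    {G : EuclideanSpace ℝ (Fin (n + 1)) → ℝ≥0∞} (hG : Measurable G) :
    ∫⁻ v in closedBall (0 : EuclideanSpace ℝ (Fin n)) 1,
      (∫⁻ σ in Icc (-1 : ℝ) 1,
        layerIntegral (weighted a G) (‖v‖⁻¹ • v) ((a + 1) * σ / ‖v‖)) ≤
      ENNReal.ofReal (a + 1)⁻¹ * ((ENNReal.ofReal ((a + 3) / (1 - |a|)) *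
        volume (closedBall (0 : EuclideanSpace ℝ (Fin n)) 2)) *
          ∫⁻ η in truncSphere n a, G η ∂(sphereMeasure n)) := by
  have h1 : 0 < a + 1 := by linarith
  refine (lintegral_lintegral_layerIntegral_le h1 (measurable_weighted ha hG)).trans ?_
  gcongr
  rw [setLIntegral_truncSphere ha ha' hG, ← lintegral_const_mul']
  · refine lintegral_mono fun x => ?_
    have hP := P_pos ha ha' x
    have hD := D_pos ha ha' x
    refine (mul_le_mul_right (volume_layer_le ha ha' x) _).trans (le_of_eq ?_)
    -- Since n ≥ 1, the truncated exponent satisfies Pⁿ⁻¹ · P = Pⁿ, the power in the surface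
    -- density.
    obtain ⟨m, rfl⟩ := Nat.exists_eq_succ_of_ne_zero (NeZero.ne n)
    rw [weighted, Nat.succ_sub_one, show (a + 1) * P a x ^ (m + 1) / D a x =
      (a + 1) * P a x ^ m / D a x * P a x by ring, ENNReal.ofReal_mul (by positivity)]
    ring
  · exact ENNReal.mul_ne_top ENNReal.ofReal_ne_top measure_closedBall_lt_top.ne

/-- `layerIntegral` over the hyperplane that corresponds to `ζ`. -/
def slicedLayer (a : ℝ) (G : EuclideanSpace ℝ (Fin (n + 1)) → ℝ≥0∞)
    (ζ : EuclideanSpace ℝ (Fin (n + 1))) : ℝ≥0∞ :=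
  layerIntegral (weighted a G) (‖horiz ζ‖⁻¹ • horiz ζ) ((a + 1) * height ζ / ‖horiz ζ‖)

theorem measurable_slicedLayer (ha : -1 < a) {G : EuclideanSpace ℝ (Fin (n + 1)) → ℝ≥0∞}
    (hG : Measurable G) : Measurable (slicedLayer a G) := by
  have h1 : Measurable (horiz (n := n)) := continuous_horiz.measurable
  have h2 : Measurable (height (n := n)) := continuous_height.measurable
  exact Measurable.comp (g := fun p : EuclideanSpace ℝ (Fin n) × ℝ =>
    layerIntegral (weighted a G) p.1 p.2)
    (f := fun ζ => (‖horiz ζ‖⁻¹ • horiz ζ, (a + 1) * height ζ / ‖horiz ζ‖))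
    (measurable_layerIntegral (measurable_weighted ha hG)) (by fun_prop)

theorem slicedLayer_smul (G : EuclideanSpace ℝ (Fin (n + 1)) → ℝ≥0∞) {c : ℝ} (hc : 0 < c)
    (ζ : EuclideanSpace ℝ (Fin (n + 1))) : slicedLayer a G (c • ζ) = slicedLayer a G ζ := by
  have h1 : horiz (c • ζ) = c • horiz ζ := by
    rw [← join_horiz_height ζ, ← join_smul, horiz_join, horiz_join]
  have h2 : height (c • ζ) = c * height ζ := by
    rw [← join_horiz_height ζ, ← join_smul, height_join, height_join]
  rw [slicedLayer, slicedLayer, h1, h2, norm_smul, Real.norm_of_nonneg hc.le, smul_smul, mul_inv]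
  have h3 : c⁻¹ * ‖horiz ζ‖⁻¹ * c = ‖horiz ζ‖⁻¹ := by field_simp
  rw [h3, mul_left_comm, mul_div_mul_left _ _ hc.ne']

theorem slicedLayer_eq {ξ : EuclideanSpace ℝ (Fin (n + 1))} (hξ : ξ ∈ unitSphere n)
    (h0 : horiz ξ ≠ 0) (ha : -1 < a) {G : EuclideanSpace ℝ (Fin (n + 1)) → ℝ≥0∞}
    (hG : Measurable G) :
    slicedLayer a G ξ = ∫⁻ u, weighted a G
      (offset a ξ • dir ξ + (u : EuclideanSpace ℝ (Fin n))) ∂(perpMeasure (dir ξ)) := by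
  obtain ⟨-, hθ, hj⟩ := dir_offset_of_mem hξ h0
  have hn : Real.sqrt (1 - height ξ ^ 2) = ‖horiz ξ‖ := by
    conv_rhs => rw [hj, horiz_join, norm_smul, hθ, mul_one,
      Real.norm_of_nonneg (Real.sqrt_nonneg _)]
  rw [← layerIntegral_eq hθ _ (measurable_weighted ha hG), slicedLayer, offset, hn, dir]

theorem setLIntegral_slicedLayer_join {G : EuclideanSpace ℝ (Fin (n + 1)) → ℝ≥0∞} (ha : -1 < a)
    (hG : Measurable G) :
    ∫⁻ q in closedBall (0 : EuclideanSpace ℝ (Fin n)) 1 ×ˢ Icc (-1 : ℝ) 1,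
        slicedLayer a G (join q.1 q.2) =
      ∫⁻ v in closedBall (0 : EuclideanSpace ℝ (Fin n)) 1,
        (∫⁻ σ in Icc (-1 : ℝ) 1,
          layerIntegral (weighted a G) (‖v‖⁻¹ • v) ((a + 1) * σ / ‖v‖)) := by
  have hm := (measurable_slicedLayer ha hG).comp continuous_join.measurable
  rw [Measure.volume_eq_prod, ← Measure.prod_restrict]
  refine (lintegral_prod _ hm.aemeasurable).trans ?_
  simp only [slicedLayer, horiz_join, height_join, Function.comp_def]

theorem ae_slicedLayer_lt_top [NeZero n] (ha : -1 < a) (ha' : a < 1)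
    {G : EuclideanSpace ℝ (Fin (n + 1)) → ℝ≥0∞} (hG : Measurable G)
    (hfin : ∫⁻ η in truncSphere n a, G η ∂(sphereMeasure n) ≠ ∞) :
    ∀ᵐ ξ ∂(sphereMeasure n), slicedLayer a G ξ < ∞ := by
  have hm := measurable_slicedLayer (n := n) ha hG
  refine ae_sphereMeasure_of_ae (measurableSet_lt hm measurable_const)
    (fun c hc ζ h => by rwa [slicedLayer_smul G hc] at h) ?_
  refine ae_lt_top (hm.comp continuous_join.measurable) ?_
  refine ne_top_of_le_ne_top ?_ ((setLIntegral_slicedLayer_join ha hG).trans_le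
    (lintegral_layerIntegral_weighted_le ha ha' hG))
  exact ENNReal.mul_ne_top ENNReal.ofReal_ne_top (ENNReal.mul_ne_top
    (ENNReal.mul_ne_top ENNReal.ofReal_ne_top measure_closedBall_lt_top.ne) hfin)

/-- Used with the indicator of a null set of Sⁿ_a: almost every slice meets it in a null set of the
slice. -/
theorem ae_slicedLayer_eq_zero [NeZero n] (ha : -1 < a) (ha' : a < 1)
    {G : EuclideanSpace ℝ (Fin (n + 1)) → ℝ≥0∞} (hG : Measurable G)
    (hzero : ∫⁻ η in truncSphere n a, G η ∂(sphereMeasure n) = 0) :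
    ∀ᵐ ξ ∂(sphereMeasure n), slicedLayer a G ξ = 0 := by
  have hm := measurable_slicedLayer (n := n) ha hG
  refine ae_sphereMeasure_of_ae (measurableSet_eq_fun hm measurable_const)
    (fun c hc ζ h => by rwa [slicedLayer_smul G hc] at h) ?_
  refine (lintegral_eq_zero_iff (hm.comp continuous_join.measurable)).1 ?_
  refine le_antisymm (((setLIntegral_slicedLayer_join ha hG).trans_le
    (lintegral_layerIntegral_weighted_le ha ha' hG)).trans ?_) zero_le
  simp [hzero]

variable {𝕜 : Type*} [RCLike 𝕜]

theorem enorm_opU (ha : -1 < a) (ha' : a < 1) (f : EuclideanSpace ℝ (Fin (n + 1)) → 𝕜)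
    (x : EuclideanSpace ℝ (Fin n)) : ‖opU a f x‖ₑ = weighted a (fun η => ‖f η‖ₑ) x := by
  have hP := P_pos ha ha' x
  have hD := D_pos ha ha' x
  have h1 : 0 < a + 1 := by linarith
  rw [opU, enorm_smul, weighted, Real.enorm_of_nonneg (by positivity)]

/-- Only a representative g of f is measurable. Finiteness is proved for g, and the vanishing of
almost all slice integrals over a Borel null set containing {f ≠ g} carries it over to f. -/
theorem ae_integrable_opU [NeZero n] (ha : -1 < a) (ha' : a < 1)
    {f : EuclideanSpace ℝ (Fin (n + 1)) → 𝕜}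
    (hf : IntegrableOn f (truncSphere n a) (sphereMeasure n)) :
    ∀ᵐ ξ ∂(sphereMeasure n), ξ ∈ unitSphere n → Integrable
      (fun u : (Submodule.span ℝ {dir ξ})ᗮ =>
        opU a f (offset a ξ • dir ξ + (u : EuclideanSpace ℝ (Fin n)))) (perpMeasure (dir ξ)) := by
  set μ := (sphereMeasure n).restrict (truncSphere n a)
  obtain ⟨g, hg, hfg⟩ := hf.1
  set N := toMeasurable μ {η | f η ≠ g η}
  have hN : MeasurableSet N := measurableSet_toMeasurable _ _
  have hN0 : μ N = 0 := by
    rw [measure_toMeasurable]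
    exact hfg
  have hG1 : Measurable fun η => ‖g η‖ₑ := hg.measurable.enorm
  have hG2 : Measurable (N.indicator (1 : EuclideanSpace ℝ (Fin (n + 1)) → ℝ≥0∞)) :=
    measurable_one.indicator hN
  have h1 := ae_slicedLayer_lt_top ha ha' hG1 (((hasFiniteIntegral_congr hfg).1 hf.2).ne)
  have h2 := ae_slicedLayer_eq_zero ha ha' hG2 (by rw [lintegral_indicator_one hN]; exact hN0)
  filter_upwards [h1, h2, ae_horiz_ne_zero] with ξ h1 h2 h0 hξ
  rw [slicedLayer_eq hξ h0 ha hG1] at h1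
  have hwm : Measurable fun u : (Submodule.span ℝ {dir ξ})ᗮ => weighted a (N.indicator 1)
      (offset a ξ • dir ξ + (u : EuclideanSpace ℝ (Fin n))) :=
    (measurable_weighted ha hG2).comp (by fun_prop)
  rw [slicedLayer_eq hξ h0 ha hG2, lintegral_eq_zero_iff hwm] at h2
  have hcp := continuous_P (n := n) ha
  have hcD := continuous_D (n := n) (a := a)
  have hgU : Integrable (fun u : (Submodule.span ℝ {dir ξ})ᗮ =>
      opU a g (offset a ξ • dir ξ + (u : EuclideanSpace ℝ (Fin n)))) (perpMeasure (dir ξ)) := by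
    constructor
    · have hU : StronglyMeasurable (opU a g : EuclideanSpace ℝ (Fin n) → 𝕜) := by
        unfold opU
        refine StronglyMeasurable.smul (Measurable.stronglyMeasurable ?_)
          (hg.comp_measurable (continuous_proj ha).measurable)
        have := hcp.measurable
        have := hcD.measurable
        fun_prop
      exact (hU.comp_measurable (by fun_prop)).aestronglyMeasurable
    · simpa only [HasFiniteIntegral, enorm_opU ha ha'] using h1
  refine hgU.congr ?_
  filter_upwards [h2] with u hu
  set x := offset a ξ • dir ξ + (u : EuclideanSpace ℝ (Fin n))
  have hP := P_pos ha ha' x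
  have hD := D_pos ha ha' x
  have ha1 : 0 < a + 1 := by linarith
  have hx : proj a x ∉ N := by
    intro hx
    have hu' : weighted a (N.indicator 1) x = 0 := hu
    rw [weighted, indicator_of_mem hx, Pi.one_apply, mul_one, ENNReal.ofReal_eq_zero] at hu'
    have : 0 < (a + 1) * P a x ^ (n - 1) / D a x := by positivity
    linarith
  have hfx : f (proj a x) = g (proj a x) := by
    by_contra hne
    exact hx (subset_toMeasurable _ _ hne)
  rw [opU, opU, hfx]

end AlmostEverywhere

end SliceTransform

end

theorem theorem4p1 {𝕜 : Type*} [RCLike 𝕜] (n : ℕ) (hn : 2 ≤ n) (a : ℝ) (ha : -1 < a) (ha' : a < 1)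
    (f : EuclideanSpace ℝ (Fin (n + 1)) → 𝕜)
    (hf : IntegrableOn f (SliceTransform.truncSphere n a) (SliceTransform.sphereMeasure n)) :
    ∀ᵐ ξ ∂((SliceTransform.sphereMeasure n).restrict (SliceTransform.upperHemisphere n)),
      IntegrableOn f (SliceTransform.slice a ξ) (SliceTransform.sliceMeasure a ξ) ∧
      Integrable
        (fun u : (Submodule.span ℝ {SliceTransform.dir ξ})ᗮ =>
          SliceTransform.opU a f
            (SliceTransform.offset a ξ • SliceTransform.dir ξ + (u : EuclideanSpace ℝ (Fin n))))
        (SliceTransform.perpMeasure (SliceTransform.dir ξ)) ∧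
      SliceTransform.sliceTransform a f ξ =
        SliceTransform.opV a (SliceTransform.radon (SliceTransform.opU a f)) ξ := by
  have : NeZero n := ⟨by omega⟩
  have hm : MeasurableSet (SliceTransform.upperHemisphere n) :=
    (Metric.isClosed_sphere.measurableSet).inter
      (measurableSet_le measurable_const SliceTransform.continuous_height.measurable)
  filter_upwards [ae_restrict_of_ae SliceTransform.ae_horiz_ne_zero,
    ae_restrict_of_ae (SliceTransform.ae_integrable_opU ha ha' hf), ae_restrict_mem hm]
    with ξ h0 hint hξ
  -- Convergence on the hyperplane is equivalent to convergence on the slice, so only the former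
  -- needs an almost-everywhere argument.
  obtain ⟨h1, h2⟩ := SliceTransform.slice_integral_identity hn ha ha' f hξ.1 h0
  exact ⟨h1.2 (hint hξ.1), hint hξ.1, h2⟩
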